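/- Let $N\ge 2$ be an integer, $\alpha\in(0,N)$ and $p\in[1,\infty)$. For $a\in(0,N)$ let $I_a(x)=A_a|x|^{-(N-a)}$ on $\mathbb R^N\setminus\{0\}$, with $A_a=\Gamma(\tfrac{N-a}{2})/(\Gamma(\tfrac a2)\pi^{N/2}2^a)$. Let $E^{\alpha,p}_{\mathrm{rad}}(\mathbb R^N)$ be the set of radial (that is, depending only on $|x|$, up to a null set) measurable functions $u:\mathbb R^N\to\mathbb R$ that are weakly differentiable, with $\int_{\mathbb R^N}|Du|^2<\infty$ and $\int_{\mathbb R^N}\bigl|I_{\alpha/2}*|u|^p\bigr|^2<\infty$. Let $\theta,\beta\in\mathbb R$; in the critical case $p(N-2)=N+\alpha$ assume moreover that $\theta\le 1$. Then there exists a constant $C>0$ such that for every $u\in E^{\alpha,p}_{\mathrm{rad}}(\mathbb R^N)$ $$ |u(x)|\le \frac{C}{|x|^\beta}\Bigl(\int_{\mathbb R^N}|Du|^2\Bigr)^{\frac\theta2}\Bigl(\int_{\mathbb R^N}\bigl|I_{\alpha/2}*|u|^p\bigr|^2\Bigr)^{\frac{1-\theta}{2p}}\qquad\text{for almost every }x\in\mathbb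 R^N $$ if and only if $$ \frac{1}{1+\frac{p}{1+\min(1,\alpha)}}\le\theta\le 1 \qquad\text{and}\qquad \beta=\theta\,\frac{N-2}{2}+(1-\theta)\,\frac{N+\alpha}{2p}>0 . $$ -/

import Mathlib

open MeasureTheory
open scoped ENNReal ContDiff

noncomputable section

/-- The Riesz kernel `I_a(x) = A_a / |x|^(N-a)` on `ℝ^N`, with
`A_a = Γ((N-a)/2) / (Γ(a/2) π^(N/2) 2^a)`. -/
def rieszKernel (N : ℕ) (a : ℝ) (x : EuclideanSpace ℝ (Fin N)) : ℝ :=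
  (Real.Gamma (((N : ℝ) - a) / 2) /
    (Real.Gamma (a / 2) * Real.pi ^ ((N : ℝ) / 2) * (2 : ℝ) ^ a)) / ‖x‖ ^ ((N : ℝ) - a)

/-- The Riesz potential `(I_a * f)(x)` of a nonnegative function `f`, with values in `[0, ∞]`. -/
def rieszPotential (N : ℕ) (a : ℝ) (f : EuclideanSpace ℝ (Fin N) → ℝ)
    (x : EuclideanSpace ℝ (Fin N)) : ℝ≥0∞ :=
  ∫⁻ y, ENNReal.ofReal (rieszKernel N a (x - y)) * ENNReal.ofReal (f y)

/-- The Coulomb energy `∫ |I_{α/2} * |u|^p|²`, with values in `[0, ∞]`. -/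
def coulombEnergy (N : ℕ) (α p : ℝ) (u : EuclideanSpace ℝ (Fin N) → ℝ) : ℝ≥0∞ :=
  ∫⁻ x, (rieszPotential N (α / 2) (fun y => |u y| ^ p) x) ^ 2

/-- `G` is the weak gradient of `u` on `ℝ^N`: both are locally integrable and
`∫ u ∂ᵢφ = - ∫ Gᵢ φ` for every test function `φ` and every `i`. -/
structure HasWeakGradient {N : ℕ} (u : EuclideanSpace ℝ (Fin N) → ℝ)
    (G : EuclideanSpace ℝ (Fin N) → EuclideanSpace ℝ (Fin N)) : Prop where
  locallyIntegrable : LocallyIntegrable u volume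
  locallyIntegrable_grad : LocallyIntegrable G volume
  integral_eq : ∀ φ : EuclideanSpace ℝ (Fin N) → ℝ, ContDiff ℝ ∞ φ → HasCompactSupport φ →
    ∀ i : Fin N,
      ∫ x, u x * fderiv ℝ φ x (EuclideanSpace.single i (1 : ℝ)) = - ∫ x, G x i * φ x

/-- The Coulomb space `Q^{α,p}(ℝ^N)`. -/
structure MemCoulomb (N : ℕ) (α p : ℝ) (u : EuclideanSpace ℝ (Fin N) → ℝ) : Prop where
  aestronglyMeasurable : AEStronglyMeasurable u volume
  energy_lt_top : coulombEnergy N α p u < ⊤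

/-- The Coulomb–Sobolev space `E^{α,p}(ℝ^N)`: the functions of the Coulomb space that are
weakly differentiable with a square integrable weak gradient. -/
structure MemCoulombSobolev (N : ℕ) (α p : ℝ) (u : EuclideanSpace ℝ (Fin N) → ℝ) : Prop where
  memCoulomb : MemCoulomb N α p u
  exists_grad : ∃ G : EuclideanSpace ℝ (Fin N) → EuclideanSpace ℝ (Fin N),
    HasWeakGradient u G ∧ MemLp G 2 volume

/-- `u` is (almost everywhere equal to) a measurable function of `|x|`. -/
def IsRadialFun {N : ℕ} (u : EuclideanSpace ℝ (Fin N) → ℝ) : Prop :=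
  ∃ f : ℝ → ℝ, Measurable f ∧ ∀ᵐ x ∂(volume : Measure (EuclideanSpace ℝ (Fin N))), u x = f ‖x‖

/-- The uniform decay estimate
`|u(x)| ≤ C |x|^(-β) (∫ |Du|²)^(θ/2) (∫ |I_{α/2} * |u|^p|²)^((1-θ)/(2p))`
holds, with one constant `C`, for all radial `u ∈ E^{α,p}(ℝ^N)` and almost all `x`. -/
def RadialDecayEstimate (N : ℕ) (α p θ β : ℝ) : Prop :=
  ∃ C : ℝ, 0 < C ∧ ∀ u : EuclideanSpace ℝ (Fin N) → ℝ,
    MemCoulombSobolev N α p u → IsRadialFun u →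
    ∀ Du : EuclideanSpace ℝ (Fin N) → EuclideanSpace ℝ (Fin N), HasWeakGradient u Du →
    ∀ᵐ x ∂(volume : Measure (EuclideanSpace ℝ (Fin N))),
      |u x| ≤ C / ‖x‖ ^ β * (∫ y, ‖Du y‖ ^ 2) ^ (θ / 2) *
        (coulombEnergy N α p u).toReal ^ ((1 - θ) / (2 * p))

end

/-! ### Calculus of functions of the norm. -/

section RadialFunctions

open Filter Topology Set

variable {E : Type*} [NormedAddCommGroup E] [InnerProductSpace ℝ E]

/-! Sufficiency. For `u x = f ‖x‖`, Cauchy-Schwarz bounds `|f a - f b|` by the Dirichlet energy `A`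
times `∫ r^(1-N)` over `[a, b]`, up to square roots and the sphere area `ω` (`radial_oscillation`).
Hence if `|f R| = M`, then `|u| ≥ M/2` on the annulus `R < |x| < R e^q` with `q = ω M² R^(N-2) /
(4A)`. Such a plateau costs Coulomb energy. Counting all pairs of points gives at least `M^(2p)
R^(N+α) q² e^((N+α-2)q)` up to constants; counting only pairs closer than the thickness gives
`q^(1+α)` in place of the last two factors. Together they give `q^k` for every `k ≥ 1 + min 1 α`
(`energy_ge_rpow`). Inserting `q` bounds `M` by a product of powers of the two energies, and the
choice `k = pθ/(1-θ)` produces the exponents of the theorem; `k ≥ 1 + min 1 α` is exactly the lower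
bound on `θ`. For `θ = 1` and `N ≥ 3` the annulus may be taken arbitrarily thick: unless `|f R|` is
controlled by the gradient alone, the Coulomb energy is infinite.

Necessity, by smooth radial test functions. Dilations force the value of `β`
(`RadialDecayEstimate.exponent_eq`). If `θ > 1`, the Coulomb energy has a negative exponent; adding
to a cutoff a dilated copy of equal Dirichlet energy makes it arbitrarily large outside the critical
case, while the value at `|x| = 1` stays at least `1` (`RadialDecayEstimate.le_one`). Bumps of
height `1` on `1 < |x| < 1 + δ` have Dirichlet energy `O(1/δ)` and Coulomb energy `O(δ^(1+κ))` for
every `0 ≤ κ < min 1 α`, which gives the lower bound on `θ` (`RadialDecayEstimate.lower_bound`).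
Given these, `β > 0` can only fail for `N = 2`, `θ = 1`, and there planar cutoffs of vanishing
Dirichlet energy contradict the estimate. -/

theorem hasFDerivAt_norm_of_ne_zero {x : E} (hx : x ≠ 0) :
    HasFDerivAt (fun y : E => ‖y‖) (‖x‖⁻¹ • innerSL ℝ x) x := by
  have h := (hasStrictFDerivAt_norm_sq x).hasFDerivAt.sqrt (by positivity)
  have hn : (0 : ℝ) < ‖x‖ := norm_pos_iff.2 hx
  simp only [Real.sqrt_sq (norm_nonneg _)] at h
  convert h using 1
  ext y
  simp
  field_simp

/-- Constancy of the profile near `0` removes the singularity of the norm at the origin. -/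
theorem contDiff_comp_norm {χ : ℝ → ℝ} (hχ : ContDiff ℝ ∞ χ) {a c : ℝ} (ha : 0 < a)
    (h : ∀ t ≤ a, χ t = c) : ContDiff ℝ ∞ (fun x : E => χ ‖x‖) := by
  rw [contDiff_iff_contDiffAt]
  intro x
  by_cases hx : x = 0
  · have : (fun x : E => χ ‖x‖) =ᶠ[𝓝 x] fun _ => c := by
      filter_upwards [Metric.ball_mem_nhds x ha] with y hy
      exact h _ (by simpa [hx] using (Metric.mem_ball.1 hy).le)
    exact contDiffAt_const.congr_of_eventuallyEq this
  · exact hχ.contDiffAt.comp x (contDiffAt_norm ℝ hx)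

theorem hasFDerivAt_comp_norm {χ : ℝ → ℝ} (hχ : ContDiff ℝ ∞ χ) {a c : ℝ} (ha : 0 < a)
    (h : ∀ t ≤ a, χ t = c) (x : E) :
    HasFDerivAt (fun x : E => χ ‖x‖) ((deriv χ ‖x‖ * ‖x‖⁻¹) • innerSL ℝ x) x := by
  by_cases hx : x = 0
  · have : (fun x : E => χ ‖x‖) =ᶠ[𝓝 x] fun _ => c := by
      filter_upwards [Metric.ball_mem_nhds x ha] with y hy
      exact h _ (by simpa [hx] using (Metric.mem_ball.1 hy).le)
    have h2 := (hasFDerivAt_const (𝕜 := ℝ) c x).congr_of_eventuallyEq this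
    simpa [hx] using h2
  · have h1 := (hχ.differentiable (by simp)).differentiableAt (x := ‖x‖) |>.hasDerivAt
    have h2 : HasFDerivAt (fun x : E => χ ‖x‖) _ x :=
      h1.comp_hasFDerivAt x (hasFDerivAt_norm_of_ne_zero hx)
    simpa [smul_smul] using h2

/-- This is the divergence of the field `χ(|x|) x`, whose components serve as test functions for the
weak gradient. -/
theorem sum_fderiv_radial {N : ℕ} {χ : ℝ → ℝ} (hχ : ContDiff ℝ ∞ χ) {a : ℝ} (ha : 0 < a)
    (h : ∀ t ≤ a, χ t = 0) (x : EuclideanSpace ℝ (Fin N)) :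
    ∑ i, fderiv ℝ (fun x : EuclideanSpace ℝ (Fin N) => χ ‖x‖ * x i) x
        (EuclideanSpace.single i (1 : ℝ)) = deriv χ ‖x‖ * ‖x‖ + N * χ ‖x‖ := by
  have key : ∀ i, fderiv ℝ (fun x : EuclideanSpace ℝ (Fin N) => χ ‖x‖ * x i) x
        (EuclideanSpace.single i (1 : ℝ)) = deriv χ ‖x‖ * ‖x‖⁻¹ * x i ^ 2 + χ ‖x‖ := by
    intro i
    have h1 := hasFDerivAt_comp_norm hχ ha h x
    have h2 : HasFDerivAt (fun x : EuclideanSpace ℝ (Fin N) => x i)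
      (EuclideanSpace.proj (𝕜 := ℝ) i) x := (EuclideanSpace.proj (𝕜 := ℝ) i).hasFDerivAt
    have h3 : HasFDerivAt (fun x : EuclideanSpace ℝ (Fin N) => χ ‖x‖ * x i) _ x := h1.mul h2
    rw [h3.fderiv]
    simp [EuclideanSpace.inner_single_right]
    ring
  simp_rw [key, Finset.sum_add_distrib, ← Finset.mul_sum]
  rw [← EuclideanSpace.real_norm_sq_eq]
  simp
  by_cases hx : ‖x‖ = 0
  · simp [hx]
  · field_simp

variable [FiniteDimensional ℝ E] [MeasurableSpace E] [BorelSpace E] [Nontrivial E]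

/-- In polar coordinates a null set of radii sweeps out a null set of the space. -/
theorem ae_norm_of_ae {P : ℝ → Prop} (h : ∀ᵐ r ∂(volume : Measure ℝ), 0 < r → P r) :
    ∀ᵐ x : E, P ‖x‖ := by
  obtain ⟨s, hs, hsm, h0⟩ := exists_measurable_superset_of_null (ae_iff.1 h)
  have hz : (fun r : ℝ => r ^ (Module.finrank ℝ E - 1) • s.indicator (fun _ => (1 : ℝ)) r)
      =ᵐ[volume.restrict (Ioi 0)] fun _ => 0 := by
    refine ae_restrict_of_ae ?_
    filter_upwards [measure_eq_zero_iff_ae_notMem.1 h0] with r hr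
    simp [hr]
  have hi : Integrable (fun x : E => s.indicator (fun _ => (1 : ℝ)) ‖x‖) volume := by
    rw [integrable_fun_norm_addHaar]
    exact (integrable_zero _ _ _).congr hz.symm
  have h1 : ∫ x : E, s.indicator (fun _ => (1 : ℝ)) ‖x‖ = 0 := by
    rw [integral_fun_norm_addHaar, integral_congr_ae hz]
    simp
  rw [integral_eq_zero_iff_of_nonneg (fun x => indicator_nonneg (by simp) _) hi] at h1
  have hne : ∀ᵐ x : E, x ≠ 0 := by simp [ae_iff]
  filter_upwards [h1, hne] with x hx hx0
  by_contra hP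
  have : ‖x‖ ∈ s := hs (by simp [hP, hx0])
  simp [this] at hx

end RadialFunctions

/-! ### Uniqueness of the weak gradient. -/

section WeakGradient

variable {N : ℕ} {u : EuclideanSpace ℝ (Fin N) → ℝ}
  {G G' : EuclideanSpace ℝ (Fin N) → EuclideanSpace ℝ (Fin N)}

theorem HasWeakGradient.locallyIntegrable_apply (h : HasWeakGradient u G) (i : Fin N) :
    LocallyIntegrable (fun x => G x i) volume := by
  intro x
  obtain ⟨s, hs, hi⟩ := h.locallyIntegrable_grad x
  exact ⟨s, hs, (EuclideanSpace.proj (𝕜 := ℝ) i).integrable_comp hi⟩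

/-- The decay estimate speaks of an arbitrary weak gradient, while membership in the space makes
only some weak gradient square integrable; uniqueness reconciles the two. -/
theorem HasWeakGradient.ae_eq (h : HasWeakGradient u G) (h' : HasWeakGradient u G') :
    G =ᵐ[volume] G' := by
  have key : ∀ i, ∀ᵐ x, G x i - G' x i = 0 := by
    intro i
    apply ae_eq_zero_of_integral_contDiff_smul_eq_zero
      ((h.locallyIntegrable_apply i).sub (h'.locallyIntegrable_apply i))
    intro g hg hgc
    have e := (h.integral_eq g hg hgc i).symm.trans (h'.integral_eq g hg hgc i)
    have i1 : Integrable (fun x => G x i * g x) := by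
      simpa [mul_comm] using (h.locallyIntegrable_apply i).integrable_smul_left_of_hasCompactSupport
        hg.continuous hgc
    have i2 : Integrable (fun x => G' x i * g x) := by
      simpa [mul_comm] using (h'.locallyIntegrable_apply i).integrable_smul_left_of_hasCompactSupport
        hg.continuous hgc
    have : ∀ x, g x • (G x i - G' x i) = G x i * g x - G' x i * g x := fun x => by
      simp only [smul_eq_mul]; ring
    simp_rw [Pi.sub_apply, this]
    rw [integral_sub i1 i2]
    linarith
  rw [← ae_all_iff] at key
  filter_upwards [key] with x hx
  ext i
  linarith [hx i]

end WeakGradient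

/-! ### Oscillation of a radial function controlled by its Dirichlet energy. -/

section Oscillation

open Filter Topology Set

/-- The area `N |B₁|` of the unit sphere of `ℝ^N`. -/
noncomputable def sphereArea (N : ℕ) : ℝ :=
  N * (volume : Measure (EuclideanSpace ℝ (Fin N))).real (Metric.ball 0 1)

theorem sphereArea_pos {N : ℕ} (hN : 0 < N) : 0 < sphereArea N := by
  have : 0 < (volume : Measure (EuclideanSpace ℝ (Fin N))).real (Metric.ball 0 1) :=
    ENNReal.toReal_pos (Metric.measure_ball_pos _ _ one_pos).ne' measure_ball_lt_top.ne
  unfold sphereArea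
  positivity

theorem integral_norm_eq {N : ℕ} (hN : 0 < N) (f : ℝ → ℝ) :
    ∫ x : EuclideanSpace ℝ (Fin N), f ‖x‖ =
      sphereArea N * ∫ y in Ioi (0 : ℝ), y ^ (N - 1) * f y := by
  have : Nonempty (Fin N) := ⟨⟨0, hN⟩⟩
  rw [integral_fun_norm_addHaar]
  simp [sphereArea, mul_assoc]

variable {N : ℕ} {u : EuclideanSpace ℝ (Fin N) → ℝ} {f : ℝ → ℝ}
  {G : EuclideanSpace ℝ (Fin N) → EuclideanSpace ℝ (Fin N)}

theorem contDiff_mul_inv_pow {ψ : ℝ → ℝ} (hψ : ContDiff ℝ ∞ ψ) {a : ℝ} (ha : 0 < a)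
    (h : ∀ t ≤ a, ψ t = 0) (n : ℕ) : ContDiff ℝ ∞ (fun t => ψ t * (t ^ n)⁻¹) := by
  rw [contDiff_iff_contDiffAt]
  intro t
  by_cases ht : t < a
  · have : (fun t => ψ t * (t ^ n)⁻¹) =ᶠ[𝓝 t] fun _ => 0 := by
      filter_upwards [Iio_mem_nhds ht] with s hs
      simp [h s (le_of_lt hs)]
    exact contDiffAt_const.congr_of_eventuallyEq this
  · have : t ≠ 0 := by intro h0; subst h0; exact ht ha
    exact hψ.contDiffAt.mul ((contDiffAt_id.pow n).inv (by positivity))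

/-- Away from the origin `x / |x|^N` is divergence free, so `ψ(|x|) x / |x|^N` has divergence
`ψ'(|x|) |x|^(1-N)`. The power of `|x|` cancels the polar Jacobian and leaves a one-dimensional weak
derivative of `f`. -/
theorem integral_profile_mul_deriv (hN : 0 < N) (huf : ∀ᵐ x, u x = f ‖x‖)
    (hG : HasWeakGradient u G) {ψ : ℝ → ℝ} (hψ : ContDiff ℝ ∞ ψ) {a b : ℝ} (ha : 0 < a)
    (h : ∀ t ≤ a, ψ t = 0) (hb : ∀ t, b ≤ t → ψ t = 0) :
    sphereArea N * ∫ r in Ioi (0 : ℝ), f r * deriv ψ r =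
      - ∫ x, inner ℝ (G x) x * (ψ ‖x‖ * (‖x‖ ^ N)⁻¹) := by
  set χ : ℝ → ℝ := fun t => ψ t * (t ^ N)⁻¹ with hχdef
  have hχ : ContDiff ℝ ∞ χ := contDiff_mul_inv_pow hψ ha h N
  have hχ0 : ∀ t ≤ a, χ t = 0 := fun t ht => by simp [hχdef, h t ht]
  have hcs : ∀ i, HasCompactSupport (fun x : EuclideanSpace ℝ (Fin N) => χ ‖x‖ * x i) := by
    intro i
    refine HasCompactSupport.intro (isCompact_closedBall (0 : EuclideanSpace ℝ (Fin N)) b) ?_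
    intro x hx
    have : b ≤ ‖x‖ := by simpa using (not_le.1 (by simpa using hx)).le
    simp [hχdef, hb _ this]
  have hcd : ∀ i, ContDiff ℝ ∞ (fun x : EuclideanSpace ℝ (Fin N) => χ ‖x‖ * x i) := fun i =>
    (contDiff_comp_norm hχ ha hχ0).mul (EuclideanSpace.proj (𝕜 := ℝ) i).contDiff
  have e := fun i => hG.integral_eq _ (hcd i) (hcs i) i
  have e1 := Finset.sum_congr (rfl : (Finset.univ : Finset (Fin N)) = _) (fun i _ => e i)
  rw [Finset.sum_neg_distrib, ← integral_finsetSum, ← integral_finsetSum] at e1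
  · simp_rw [← Finset.mul_sum, sum_fderiv_radial hχ ha hχ0] at e1
    have e2 : ∫ x : EuclideanSpace ℝ (Fin N), u x * (deriv χ ‖x‖ * ‖x‖ + N * χ ‖x‖) =
        ∫ x : EuclideanSpace ℝ (Fin N), (fun r => f r * (deriv χ r * r + N * χ r)) ‖x‖ := by
      apply integral_congr_ae
      filter_upwards [huf] with x hx
      rw [hx]
    rw [e2.trans (integral_norm_eq hN (fun r => f r * (deriv χ r * r + N * χ r)))] at e1
    have e3 : ∫ y in Ioi (0 : ℝ), y ^ (N - 1) * (f y * (deriv χ y * y + N * χ y)) =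
        ∫ r in Ioi (0 : ℝ), f r * deriv ψ r := by
      apply setIntegral_congr_fun measurableSet_Ioi
      intro y hy
      have hy0 : (y : ℝ) ≠ 0 := (ne_of_gt hy)
      have hd1 : HasDerivAt ψ (deriv ψ y) y :=
        (hψ.differentiable (by simp)).differentiableAt.hasDerivAt
      have hd2 := hd1.mul ((hasDerivAt_pow N y).inv (pow_ne_zero N hy0))
      have hd : deriv χ y = _ := hd2.deriv
      dsimp only
      rw [hd]
      simp only [hχdef]
      obtain ⟨m, rfl⟩ : ∃ m, N = m + 1 := ⟨N - 1, by omega⟩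
      simp only [Nat.add_sub_cancel, Pi.inv_apply]
      field_simp
      ring
    rw [e3] at e1
    rw [e1]
    congr 1
    apply integral_congr_ae
    refine Eventually.of_forall fun x => ?_
    simp only [PiLp.inner_apply, hχdef, Finset.sum_mul]
    apply Finset.sum_congr rfl
    intro i _
    simp
    ring
  · intro i _
    simpa [mul_comm] using
      (hG.locallyIntegrable_apply i).integrable_smul_left_of_hasCompactSupport
        (hcd i).continuous (hcs i)
  · intro i _
    have hc : Continuous fun x => fderiv ℝ (fun x : EuclideanSpace ℝ (Fin N) => χ ‖x‖ * x i) x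
        (EuclideanSpace.single i (1 : ℝ)) :=
      ((hcd i).continuous_fderiv (by simp)).clm_apply continuous_const
    have hs : HasCompactSupport fun x =>
        fderiv ℝ (fun x : EuclideanSpace ℝ (Fin N) => χ ‖x‖ * x i) x
        (EuclideanSpace.single i (1 : ℝ)) := (hcs i).fderiv_apply (𝕜 := ℝ) _
    simpa [mul_comm] using hG.locallyIntegrable.integrable_smul_left_of_hasCompactSupport hc hs

/-- Cauchy-Schwarz against the same field: its squared length is at most `|x|^(2-2N)` on the support
of `ψ`, and the Jacobian turns this into `r^(1-N)`. -/
theorem abs_integral_profile_mul_deriv_le (hN : 0 < N) (huf : ∀ᵐ x, u x = f ‖x‖)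
    (hG : HasWeakGradient u G) (hG2 : MemLp G 2 volume)
    {ψ : ℝ → ℝ} (hψ : ContDiff ℝ ∞ ψ) {a b : ℝ} (ha : 0 < a) (hab : a ≤ b)
    (h : ∀ t ≤ a, ψ t = 0) (hb : ∀ t, b ≤ t → ψ t = 0) (h0 : ∀ t, 0 ≤ ψ t) (h1 : ∀ t, ψ t ≤ 1) :
    sphereArea N * |∫ r in Ioi (0 : ℝ), f r * deriv ψ r| ≤
      √(∫ x, ‖G x‖ ^ 2) * √(sphereArea N * ∫ r in a..b, (r ^ (N - 1))⁻¹) := by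
  have hω := sphereArea_pos hN
  rw [← abs_of_pos hω, ← abs_mul, abs_of_pos hω, integral_profile_mul_deriv hN huf hG hψ ha h hb,
    abs_neg]
  set χ : ℝ → ℝ := fun t => ψ t * (t ^ N)⁻¹ with hχdef
  have hχ : ContDiff ℝ ∞ χ := contDiff_mul_inv_pow hψ ha h N
  have hχ0 : ∀ t ≤ a, χ t = 0 := fun t ht => by simp [hχdef, h t ht]
  set g : EuclideanSpace ℝ (Fin N) → ℝ := fun x => ‖x‖ * χ ‖x‖ with hg
  have hgc : Continuous g := continuous_norm.mul (contDiff_comp_norm hχ ha hχ0).continuous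
  have hgs : HasCompactSupport g := by
    refine HasCompactSupport.intro (isCompact_closedBall (0 : EuclideanSpace ℝ (Fin N)) b) ?_
    intro x hx
    have : b ≤ ‖x‖ := by simpa using (not_le.1 (by simpa using hx)).le
    simp [hg, hχdef, hb _ this]
  have hχnn : ∀ x : EuclideanSpace ℝ (Fin N), 0 ≤ χ ‖x‖ := fun x =>
    mul_nonneg (h0 _) (by positivity)
  have hgnn : ∀ x, 0 ≤ g x := fun x => mul_nonneg (norm_nonneg _) (hχnn x)
  have hgL : MemLp g 2 volume := hgc.memLp_of_hasCompactSupport hgs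
  calc |∫ x, inner ℝ (G x) x * (ψ ‖x‖ * (‖x‖ ^ N)⁻¹)|
      ≤ ∫ x, ‖G x‖ * g x := by
        rw [← Real.norm_eq_abs]
        refine norm_integral_le_of_norm_le (hG2.norm.integrable_mul hgL) ?_
        refine Eventually.of_forall fun x => ?_
        rw [norm_mul, hg]
        have := hχnn x
        simp only [hχdef] at this
        rw [Real.norm_of_nonneg this]
        refine (mul_le_mul_of_nonneg_right (norm_inner_le_norm (𝕜 := ℝ) (G x) x) this).trans_eq ?_
        simp only [hχdef]
        ring
    _ ≤ (∫ x, ‖G x‖ ^ (2 : ℝ)) ^ (1 / (2 : ℝ)) * (∫ x, g x ^ (2 : ℝ)) ^ (1 / (2 : ℝ)) :=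
        integral_mul_le_Lp_mul_Lq_of_nonneg Real.HolderConjugate.two_two
          (Eventually.of_forall fun x => norm_nonneg _) (Eventually.of_forall hgnn)
          (by simpa using hG2.norm) (by simpa using hgL)
    _ ≤ _ := by
        simp only [← Real.sqrt_eq_rpow, Real.rpow_two]
        refine mul_le_mul_of_nonneg_left (Real.sqrt_le_sqrt ?_) (Real.sqrt_nonneg _)
        have := integral_norm_eq hN (fun r => (r * χ r) ^ 2)
        simp only [hg]
        rw [this]
        refine mul_le_mul_of_nonneg_left ?_ hω.le
        rw [intervalIntegral.integral_of_le hab]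
        have hint : IntegrableOn (fun r : ℝ => (r ^ (N - 1))⁻¹) (Ioc a b) := by
          apply (ContinuousOn.integrableOn_Icc ?_).mono_set Ioc_subset_Icc_self
          intro r hr
          have : r ≠ 0 := (ha.trans_le hr.1).ne'
          exact ((continuousAt_id.pow _).inv₀ (pow_ne_zero _ this)).continuousWithinAt
        have hsub : Ioc a b ⊆ Ioi 0 := fun r hr => ha.trans hr.1
        rw [← integral_indicator measurableSet_Ioi, ← integral_indicator measurableSet_Ioc]
        refine integral_mono_of_nonneg (Eventually.of_forall fun r => ?_)
          (hint.integrable_indicator measurableSet_Ioc) (Eventually.of_forall fun r => ?_)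
        · refine indicator_nonneg (fun r hr => ?_) _
          have : (0 : ℝ) < r := hr
          positivity
        · by_cases hr : r ∈ Ioc a b
          · have hr0 : 0 < r := hsub hr
            simp only [indicator_of_mem hr, indicator_of_mem (hsub hr), hχdef]
            obtain ⟨m, hm⟩ : ∃ m, N = m + 1 := ⟨N - 1, by omega⟩
            have hψ2 : ψ r ^ 2 ≤ 1 := pow_le_one₀ (h0 r) (h1 r)
            have : r ^ (N - 1) * (r * (ψ r * (r ^ N)⁻¹)) ^ 2 = ψ r ^ 2 * (r ^ (N - 1))⁻¹ := by
              subst hm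
              simp only [Nat.add_sub_cancel]
              field_simp
              ring
            rw [this]
            have : 0 ≤ (r ^ (N - 1))⁻¹ := by positivity
            nlinarith
          · rw [indicator_of_notMem hr]
            by_cases hr0 : r ∈ Ioi (0 : ℝ)
            · rw [indicator_of_mem hr0]
              have : ψ r = 0 := by
                by_cases hra : r ≤ a
                · exact h r hra
                · exact hb r (le_of_lt (not_le.1 fun hh => hr ⟨not_le.1 hra, hh⟩))
              simp [hχdef, this]
            · rw [indicator_of_notMem hr0]

/-- The primitive of a normalized bump function: a smooth step from `0` to `1`. -/
noncomputable def bumpStep (φ : ContDiffBump (0 : ℝ)) (r : ℝ) : ℝ :=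
  ∫ t in (-φ.rOut)..r, φ.normed volume t

theorem hasDerivAt_bumpStep (φ : ContDiffBump (0 : ℝ)) (r : ℝ) :
    HasDerivAt (bumpStep φ) (φ.normed volume r) r :=
  intervalIntegral.integral_hasDerivAt_right (φ.continuous_normed.intervalIntegrable _ _)
    (φ.continuous_normed.stronglyMeasurableAtFilter _ _) φ.continuous_normed.continuousAt

theorem contDiff_bumpStep (φ : ContDiffBump (0 : ℝ)) : ContDiff ℝ ∞ (bumpStep φ) := by
  rw [contDiff_infty_iff_deriv]
  refine ⟨fun r => (hasDerivAt_bumpStep φ r).differentiableAt, ?_⟩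
  have : deriv (bumpStep φ) = φ.normed volume := funext fun r => (hasDerivAt_bumpStep φ r).deriv
  rw [this]
  exact φ.contDiff_normed

theorem monotone_bumpStep (φ : ContDiffBump (0 : ℝ)) : Monotone (bumpStep φ) := by
  refine monotone_of_deriv_nonneg (fun r => (hasDerivAt_bumpStep φ r).differentiableAt) fun r => ?_
  rw [(hasDerivAt_bumpStep φ r).deriv]
  exact φ.nonneg_normed r

theorem normed_eq_zero_of_le_abs (φ : ContDiffBump (0 : ℝ)) {t : ℝ} (ht : φ.rOut ≤ |t|) :
    φ.normed volume t = 0 := by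
  by_contra h
  have : t ∈ Function.support (φ.normed volume) := h
  rw [φ.support_normed_eq] at this
  simp at this
  linarith

theorem bumpStep_of_le (φ : ContDiffBump (0 : ℝ)) {r : ℝ} (hr : r ≤ -φ.rOut) :
    bumpStep φ r = 0 := by
  have : ∀ t ∈ uIcc (-φ.rOut) r, φ.normed volume t = (fun _ => (0 : ℝ)) t := by
    intro t ht
    rw [uIcc_of_ge hr] at ht
    apply normed_eq_zero_of_le_abs
    have := φ.rOut_pos
    rw [abs_of_nonpos (by linarith [ht.2])]
    linarith [ht.2]
  rw [bumpStep, intervalIntegral.integral_congr this]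
  simp

theorem bumpStep_of_ge (φ : ContDiffBump (0 : ℝ)) {r : ℝ} (hr : φ.rOut ≤ r) :
    bumpStep φ r = 1 := by
  have h0 := φ.rOut_pos
  rw [bumpStep, intervalIntegral.integral_of_le (by linarith)]
  rw [← φ.integral_normed (μ := volume)]
  apply setIntegral_eq_integral_of_forall_compl_eq_zero
  intro t ht
  apply normed_eq_zero_of_le_abs
  rw [mem_Ioc, not_and_or, not_lt, not_le] at ht
  rcases ht with ht | ht
  · rw [abs_of_nonpos (by linarith)]; linarith
  · rw [abs_of_nonneg (by linarith)]; linarith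

/-- The Jacobian `r^(N-1)` is bounded below on `[c, d]` only because `c > 0`; near the origin the
profile need not be integrable. -/
theorem integrableOn_profile (hN : 0 < N) (huf : ∀ᵐ x, u x = f ‖x‖)
    (hu : LocallyIntegrable u volume) {c d : ℝ} (hc : 0 < c) : IntegrableOn f (Icc c d) := by
  have : Nonempty (Fin N) := ⟨⟨0, hN⟩⟩
  have h1 : IntegrableOn u (Metric.closedBall 0 d) :=
    hu.integrableOn_isCompact (isCompact_closedBall _ _)
  have h2 : Integrable (fun x : EuclideanSpace ℝ (Fin N) => (Iic d).indicator f ‖x‖) := by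
    have := h1.integrable_indicator Metric.isClosed_closedBall.measurableSet
    refine this.congr ?_
    filter_upwards [huf] with x hx
    by_cases hd : ‖x‖ ≤ d
    · simp [indicator, hd, hx]
    · simp [indicator, hd]
  rw [integrable_fun_norm_addHaar] at h2
  have h3 := h2.mono_set (fun r (hr : r ∈ Icc c d) => (hc.trans_le hr.1 : (0:ℝ) < r))
  have hcont : ContinuousOn (fun r : ℝ => (r ^ (Module.finrank ℝ (EuclideanSpace ℝ (Fin N)) - 1))⁻¹)
      (Icc c d) := by
    intro r hr
    have : r ≠ 0 := (hc.trans_le hr.1).ne'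
    exact ((continuousAt_id.pow _).inv₀ (pow_ne_zero _ this)).continuousWithinAt
  have h4 := IntegrableOn.continuousOn_mul hcont h3 isCompact_Icc
  refine h4.congr_fun (fun r hr => ?_) measurableSet_Icc
  have : r ≠ 0 := (hc.trans_le hr.1).ne'
  simp [indicator, hr.2]
  field_simp

theorem continuousAt_primitive_inv_pow (n : ℕ) {r : ℝ} (hr : 0 < r) :
    ContinuousAt (fun r => ∫ t in (1 : ℝ)..r, (t ^ n)⁻¹) r := by
  have hc : ∀ s : ℝ, 0 < s → ContinuousAt (fun t : ℝ => (t ^ n)⁻¹) s := fun s hs =>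
    (continuousAt_id.pow _).inv₀ (pow_ne_zero _ hs.ne')
  refine (intervalIntegral.integral_hasDerivAt_right ?_ ?_ (hc r hr)).continuousAt
  · apply ContinuousOn.intervalIntegrable
    intro t ht
    exact (hc t ((lt_min one_pos hr).trans_le ht.1)).continuousWithinAt
  · have hco : ContinuousOn (fun t : ℝ => (t ^ n)⁻¹) (Ioi 0) := fun t ht =>
      (hc t ht).continuousWithinAt
    exact hco.stronglyMeasurableAtFilter isOpen_Ioi r hr

theorem intervalIntegrable_inv_pow (n : ℕ) {a b : ℝ} (ha : 0 < a) (hb : 0 < b) :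
    IntervalIntegrable (fun t : ℝ => (t ^ n)⁻¹) volume a b := by
  apply ContinuousOn.intervalIntegrable
  intro t ht
  have ht0 : 0 < t := (lt_min ha hb).trans_le ht.1
  exact ((continuousAt_id.pow _).inv₀ (pow_ne_zero _ ht0.ne')).continuousWithinAt

/-- A radial function with square integrable weak gradient is Hölder continuous away from the
origin, with the modulus given by the Cauchy-Schwarz inequality. -/
theorem radial_oscillation (hN : 0 < N) (huf : ∀ᵐ x, u x = f ‖x‖)
    (hG : HasWeakGradient u G) (hG2 : MemLp G 2 volume) :
    ∃ S : Set ℝ, (∀ᵐ r, r ∈ S) ∧ ∀ a ∈ S, ∀ b ∈ S, 0 < a → a < b →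
      sphereArea N * |f a - f b| ≤
        √(∫ x, ‖G x‖ ^ 2) * √(sphereArea N * ∫ r in a..b, (r ^ (N - 1))⁻¹) := by
  set φ : ℕ → ContDiffBump (0 : ℝ) := fun i =>
    ⟨1 / (i + 1) / 2, 1 / (i + 1), by positivity, half_lt_self (by positivity)⟩ with hφ
  have hφt : Tendsto (fun i => (φ i).rOut) atTop (𝓝 0) := tendsto_one_div_add_atTop_nhds_zero_nat
  -- Truncations of `f` to compact subintervals of `(0, ∞)` are locally integrable on the line.
  -- Being countably many, they share a set of full measure on which all their mollifications
  -- converge; this set is the required `S`.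
  set g : ℕ → ℝ → ℝ := fun n => (Icc (1 / (n + 1 : ℝ)) (n + 1)).indicator f with hg
  have hgi : ∀ n, LocallyIntegrable (g n) volume := fun n =>
    ((integrableOn_profile hN huf hG.locallyIntegrable (by positivity)).integrable_indicator
      measurableSet_Icc).locallyIntegrable
  have hconv : ∀ᵐ r, ∀ n, Tendsto (fun i => ∫ t, (φ i).normed volume (r - t) * g n t) atTop
      (𝓝 (g n r)) := by
    rw [ae_all_iff]
    intro n
    have := ContDiffBump.ae_convolution_tendsto_right_of_locallyIntegrable (K := 2) hφt
      (Eventually.of_forall fun i => by simp only [hφ]; linarith) (hgi n)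
    filter_upwards [this] with r hr
    simpa [convolution_eq_swap] using hr
  refine ⟨_, hconv, ?_⟩
  intro a ha b hb ha0 hab
  obtain ⟨n, hn1, hn2⟩ : ∃ n : ℕ, 1 / (n + 1 : ℝ) < a ∧ b < n + 1 := by
    obtain ⟨n1, h1⟩ := exists_nat_one_div_lt ha0
    obtain ⟨n2, h2⟩ := exists_nat_gt b
    refine ⟨max n1 n2, lt_of_le_of_lt ?_ h1, h2.trans_le ?_⟩
    · apply one_div_le_one_div_of_le (by positivity)
      simp
    · have : (n2 : ℝ) ≤ (max n1 n2 : ℕ) := by exact_mod_cast le_max_right _ _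
      linarith
  have hc0 : 0 < 1 / (n + 1 : ℝ) := by positivity
  set c : ℝ := 1 / (n + 1 : ℝ) with hc
  set d : ℝ := (n + 1 : ℝ) with hd
  have hga : g n a = f a := indicator_of_mem (show a ∈ Icc c d from ⟨hn1.le, by linarith⟩) _
  have hgb : g n b = f b := indicator_of_mem (show b ∈ Icc c d from ⟨by linarith, hn2.le⟩) _
  have T1 := ((ha n).sub (hb n)).abs.const_mul (sphereArea N)
  rw [hga, hgb] at T1
  have hP : Tendsto (fun i => ∫ r in (a - (φ i).rOut)..(b + (φ i).rOut), (r ^ (N - 1))⁻¹) atTop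
      (𝓝 (∫ r in a..b, (r ^ (N - 1))⁻¹)) := by
    have t1 : Tendsto (fun i => a - (φ i).rOut) atTop (𝓝 a) := by
      simpa using tendsto_const_nhds.sub hφt
    have t2 : Tendsto (fun i => b + (φ i).rOut) atTop (𝓝 b) := by
      simpa using tendsto_const_nhds.add hφt
    have t3 := ((continuousAt_primitive_inv_pow (N - 1) (ha0.trans hab)).tendsto.comp t2).sub
      ((continuousAt_primitive_inv_pow (N - 1) ha0).tendsto.comp t1)
    rw [intervalIntegral.integral_interval_sub_left
      (intervalIntegrable_inv_pow _ one_pos (ha0.trans hab))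
      (intervalIntegrable_inv_pow _ one_pos ha0)] at t3
    refine t3.congr' ?_
    filter_upwards [t1.eventually (lt_mem_nhds ha0)] with i hi
    simp only [Function.comp_apply]
    rw [intervalIntegral.integral_interval_sub_left
      (intervalIntegrable_inv_pow _ one_pos (by have := (φ i).rOut_pos; linarith))
      (intervalIntegrable_inv_pow _ one_pos hi)]
  have T2 := ((hP.const_mul (sphereArea N)).sqrt).const_mul (√(∫ x, ‖G x‖ ^ 2))
  refine le_of_tendsto_of_tendsto T1 T2 ?_
  filter_upwards [hφt.eventually (gt_mem_nhds (sub_pos.2 hn1)),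
    hφt.eventually (gt_mem_nhds (sub_pos.2 hn2))] with i hi1 hi2
  have hε := (φ i).rOut_pos
  set ε := (φ i).rOut with hεd
  -- A smoothed indicator of `[a, b]`. Its derivative is the mollifier at `a` minus the one at `b`,
  -- so `∫ f ψ'` is the difference of the mollified profiles and tends to `f a - f b`.
  set ψ : ℝ → ℝ := fun r => bumpStep (φ i) (r - a) - bumpStep (φ i) (r - b) with hψd
  have hψ : ContDiff ℝ ∞ ψ :=
    ((contDiff_bumpStep (φ i)).comp (contDiff_id.sub contDiff_const)).sub
      ((contDiff_bumpStep (φ i)).comp (contDiff_id.sub contDiff_const))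
  have hm := monotone_bumpStep (φ i)
  have h01 : ∀ r, 0 ≤ bumpStep (φ i) r ∧ bumpStep (φ i) r ≤ 1 := by
    intro r
    constructor
    · rw [← bumpStep_of_le (φ i) (min_le_right r (-(φ i).rOut))]
      exact hm (min_le_left _ _)
    · rw [← bumpStep_of_ge (φ i) (le_max_right r (φ i).rOut)]
      exact hm (le_max_left _ _)
  have key := abs_integral_profile_mul_deriv_le hN huf hG hG2 hψ (a := a - ε) (b := b + ε)
    (by linarith) (by linarith)
    (fun t ht => by
      simp only [hψd]
      rw [bumpStep_of_le, bumpStep_of_le] <;> linarith)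
    (fun t ht => by
      simp only [hψd]
      rw [bumpStep_of_ge, bumpStep_of_ge] <;> linarith)
    (fun t => sub_nonneg.2 (hm (by linarith)))
    (fun t => by
      have h1 := (h01 (t - a)).2
      have h2 := (h01 (t - b)).1
      simp only [hψd]
      linarith)
  have hdψ : ∀ r, deriv ψ r = (φ i).normed volume (a - r) - (φ i).normed volume (b - r) := by
    intro r
    have h1 := (hasDerivAt_bumpStep (φ i) (r - a)).comp_sub_const r a
    have h2 := (hasDerivAt_bumpStep (φ i) (r - b)).comp_sub_const r b
    have h3 : HasDerivAt ψ _ r := h1.sub h2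
    rw [h3.deriv, ← (φ i).normed_neg (r - a), ← (φ i).normed_neg (r - b), neg_sub, neg_sub]
  have hint : ∀ x, Integrable fun t => (φ i).normed volume (x - t) * g n t := by
    intro x
    have hcs : HasCompactSupport fun t => (φ i).normed volume (x - t) :=
      (φ i).hasCompactSupport_normed.comp_homeomorph (Homeomorph.subLeft x)
    simpa using (hgi n).integrable_smul_left_of_hasCompactSupport
      ((φ i).continuous_normed.comp (continuous_const.sub continuous_id)) hcs
  suffices hs : ∫ r in Ioi (0 : ℝ), f r * deriv ψ r =
      (∫ t, (φ i).normed volume (a - t) * g n t) - ∫ t, (φ i).normed volume (b - t) * g n t by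
    rwa [hs] at key
  rw [← integral_sub (hint a) (hint b), ← integral_indicator measurableSet_Ioi]
  refine integral_congr_ae (Eventually.of_forall fun r => ?_)
  simp only [hg]
  have hz : ∀ x, a ≤ x → x ≤ b → r ∉ Icc c d → (φ i).normed volume (x - r) = 0 := by
    intro x hx1 hx2 hr
    apply normed_eq_zero_of_le_abs
    rw [mem_Icc, not_and_or, not_le, not_le] at hr
    rcases hr with hr | hr
    · rw [abs_of_nonneg (by linarith)]; linarith
    · rw [abs_of_nonpos (by linarith)]; linarith
  by_cases hr : r ∈ Icc c d
  · rw [indicator_of_mem hr, indicator_of_mem (show r ∈ Ioi (0 : ℝ) from hc0.trans_le hr.1), hdψ]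
    ring
  · rw [indicator_of_notMem hr]
    simp only [mul_zero, sub_zero]
    by_cases hr0 : r ∈ Ioi (0 : ℝ)
    · rw [indicator_of_mem hr0, hdψ, hz a le_rfl hab.le hr, hz b hab.le le_rfl hr]
      simp
    · rw [indicator_of_notMem hr0]

end Oscillation

/-! ### Lower bounds for the Coulomb energy of a plateau on an annulus. -/

section EnergyLowerBound

open Filter Topology Set

variable {N : ℕ} {α p : ℝ} {u : EuclideanSpace ℝ (Fin N) → ℝ}

/-- The normalization constant of the Riesz kernel. -/
noncomputable def rieszConst (N : ℕ) (a : ℝ) : ℝ :=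
  Real.Gamma (((N : ℝ) - a) / 2) / (Real.Gamma (a / 2) * Real.pi ^ ((N : ℝ) / 2) * (2 : ℝ) ^ a)

theorem rieszConst_pos {a : ℝ} (ha : 0 < a) (haN : a < N) : 0 < rieszConst N a := by
  have h1 := Real.Gamma_pos_of_pos (show 0 < ((N : ℝ) - a) / 2 by linarith)
  have h2 := Real.Gamma_pos_of_pos (show 0 < a / 2 by linarith)
  unfold rieszConst
  positivity

/-- Keep only `x ∈ X` and `y ∈ T` with `|x - y| ≤ d`; there the kernel is at least its value at
distance `d`. -/
theorem coulombEnergy_ge (hN : 0 < N) (hα : 0 < α) (hαN : α < N) (hp : 0 ≤ p)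
    {T X : Set (EuclideanSpace ℝ (Fin N))} (hTm : MeasurableSet T) (hX : MeasurableSet X)
    {h : ℝ} (hh : 0 ≤ h) (hT : ∀ᵐ y, y ∈ T → h ≤ |u y|) {d : ℝ} (hd : 0 < d) {τ : ℝ≥0∞}
    (hτ : ∀ x ∈ X, τ ≤ volume (T ∩ Metric.closedBall x d)) :
    (ENNReal.ofReal (rieszConst N (α / 2) / d ^ ((N : ℝ) - α / 2) * h ^ p) * τ) ^ 2 * volume X ≤
      coulombEnergy N α p u := by
  have hc := rieszConst_pos (N := N) (a := α / 2) (by linarith) (by linarith)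
  rw [← setLIntegral_const]
  refine (setLIntegral_mono_ae' hX (Eventually.of_forall fun x hx => ?_)).trans
    (setLIntegral_le_lintegral X _)
  gcongr
  have hB : MeasurableSet (T ∩ Metric.closedBall x d) :=
    hTm.inter Metric.isClosed_closedBall.measurableSet
  have : Nonempty (Fin N) := ⟨⟨0, hN⟩⟩
  have hne : ∀ᵐ y : EuclideanSpace ℝ (Fin N), y ≠ x := by simp [ae_iff]
  calc _ ≤ ENNReal.ofReal (rieszConst N (α / 2) / d ^ ((N : ℝ) - α / 2) * h ^ p) *
          volume (T ∩ Metric.closedBall x d) := by gcongr; exact hτ x hx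
    _ = ∫⁻ y in T ∩ Metric.closedBall x d,
          ENNReal.ofReal (rieszConst N (α / 2) / d ^ ((N : ℝ) - α / 2) * h ^ p) :=
        (setLIntegral_const _ _).symm
    _ ≤ ∫⁻ y in T ∩ Metric.closedBall x d,
          ENNReal.ofReal (rieszKernel N (α / 2) (x - y)) * ENNReal.ofReal (|u y| ^ p) := by
        refine setLIntegral_mono_ae' hB ?_
        filter_upwards [hT, hne] with y hy hyx hyT
        rw [ENNReal.ofReal_mul (by positivity)]
        have hpos : 0 < ‖x - y‖ := norm_pos_iff.2 (sub_ne_zero.2 (Ne.symm hyx))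
        have hle : ‖x - y‖ ≤ d := by
          have := hyT.2
          rwa [Metric.mem_closedBall, dist_comm, dist_eq_norm] at this
        have hexp : 0 ≤ (N : ℝ) - α / 2 := by linarith
        gcongr
        · show _ ≤ rieszConst N (α / 2) / _
          gcongr
        · exact hy hyT.1
    _ ≤ _ := setLIntegral_le_lintegral _ _

/-- The volume of the unit ball of `ℝ^N`. -/
noncomputable def ballVolume (N : ℕ) : ℝ :=
  (volume : Measure (EuclideanSpace ℝ (Fin N))).real (Metric.ball 0 1)

theorem ballVolume_pos : 0 < ballVolume N :=
  ENNReal.toReal_pos (Metric.measure_ball_pos _ _ one_pos).ne' measure_ball_lt_top.ne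

theorem volume_ball_eq (hN : 0 < N) (x : EuclideanSpace ℝ (Fin N)) {r : ℝ} (hr : 0 ≤ r) :
    volume (Metric.ball x r) = ENNReal.ofReal (r ^ N * ballVolume N) := by
  have : Nonempty (Fin N) := ⟨⟨0, hN⟩⟩
  rw [Measure.addHaar_ball _ _ hr, ENNReal.ofReal_mul (by positivity), ballVolume,
    ofReal_measureReal measure_ball_lt_top.ne]
  simp

theorem volume_closedBall_eq (x : EuclideanSpace ℝ (Fin N)) {r : ℝ} (hr : 0 ≤ r) :
    volume (Metric.closedBall x r) = ENNReal.ofReal (r ^ N * ballVolume N) := by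
  rw [Measure.addHaar_closedBall _ _ hr, ENNReal.ofReal_mul (by positivity), ballVolume,
    ofReal_measureReal measure_ball_lt_top.ne]
  simp

/-- The open annulus of radii `R < L` centred at the origin. -/
def annulus (N : ℕ) (R L : ℝ) : Set (EuclideanSpace ℝ (Fin N)) := {x | R < ‖x‖ ∧ ‖x‖ < L}

theorem annulus_eq (R L : ℝ) : annulus N R L = Metric.ball 0 L \ Metric.closedBall 0 R := by
  ext x
  simp [annulus, and_comm]

theorem measurableSet_annulus (R L : ℝ) : MeasurableSet (annulus N R L) := by
  rw [annulus_eq]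
  exact Metric.isOpen_ball.measurableSet.diff Metric.isClosed_closedBall.measurableSet

theorem volume_annulus (hN : 0 < N) {R L : ℝ} (hR : 0 ≤ R) (hRL : R < L) :
    volume (annulus N R L) = ENNReal.ofReal ((L ^ N - R ^ N) * ballVolume N) := by
  rw [annulus_eq, measure_sdiff (Metric.closedBall_subset_ball hRL)
    Metric.isClosed_closedBall.measurableSet.nullMeasurableSet measure_closedBall_lt_top.ne,
    volume_ball_eq hN _ (hR.trans hRL.le), volume_closedBall_eq _ hR, ← ENNReal.ofReal_sub]
  · ring_nf
  · have := ballVolume_pos (N := N)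
    positivity

/-- Long-range interactions: with `d = 2L`, every point of the ball of radius `L` sees the whole
annulus. -/
theorem energy_ge_global (hN : 0 < N) (hα : 0 < α) (hαN : α < N) (hp : 0 ≤ p)
    (hE : coulombEnergy N α p u ≠ ⊤) {R L h : ℝ} (hR : 0 < R) (hRL : R < L) (hh : 0 ≤ h)
    (hu : ∀ᵐ x, x ∈ annulus N R L → h ≤ |u x|) :
    (rieszConst N (α / 2) / (2 * L) ^ ((N : ℝ) - α / 2) * h ^ p *
      ((L ^ N - R ^ N) * ballVolume N)) ^ 2 * (L ^ N * ballVolume N) ≤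
      (coulombEnergy N α p u).toReal := by
  have hc := rieszConst_pos (N := N) (a := α / 2) (by linarith) (by linarith)
  have hv := ballVolume_pos (N := N)
  have hL : 0 < L := hR.trans hRL
  have hsub : 0 ≤ L ^ N - R ^ N := sub_nonneg.2 (pow_le_pow_left₀ hR.le hRL.le N)
  rw [← ENNReal.ofReal_le_iff_le_toReal hE]
  have := coulombEnergy_ge hN hα hαN hp (measurableSet_annulus R L)
    (Metric.isOpen_ball (x := (0 : EuclideanSpace ℝ (Fin N))) (ε := L)).measurableSet hh hu
    (d := 2 * L) (by linarith) (τ := volume (annulus N R L)) (by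
      intro x hx
      apply measure_mono
      intro y hy
      refine ⟨hy, ?_⟩
      rw [Metric.mem_closedBall, dist_eq_norm]
      have h1 : ‖x‖ < L := by simpa using hx
      have := norm_sub_le y x
      linarith [hy.2])
  rw [volume_annulus hN hR.le hRL, volume_ball_eq hN _ hL.le, ← ENNReal.ofReal_mul (by positivity),
    ← ENNReal.ofReal_pow (by positivity), ← ENNReal.ofReal_mul (by positivity)] at this
  exact this

/-- Short-range interactions, at distances up to the thickness `d = L - R`. For thin annuli this is
the better bound when `α < 1`. -/
theorem energy_ge_local (hN : 0 < N) (hα : 0 < α) (hαN : α < N) (hp : 0 ≤ p)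
    (hE : coulombEnergy N α p u ≠ ⊤) {R L h : ℝ} (hR : 0 < R) (hRL : R < L) (hh : 0 ≤ h)
    (hu : ∀ᵐ x, x ∈ annulus N R L → h ≤ |u x|) :
    (rieszConst N (α / 2) / (L - R) ^ ((N : ℝ) - α / 2) * h ^ p *
      (((L - R) / 2) ^ N * ballVolume N)) ^ 2 * ((L ^ N - R ^ N) * ballVolume N) ≤
      (coulombEnergy N α p u).toReal := by
  have hc := rieszConst_pos (N := N) (a := α / 2) (by linarith) (by linarith)
  have hv := ballVolume_pos (N := N)
  have hL : 0 < L := hR.trans hRL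
  have hd : 0 < L - R := sub_pos.2 hRL
  have hsub : 0 ≤ L ^ N - R ^ N := sub_nonneg.2 (pow_le_pow_left₀ hR.le hRL.le N)
  rw [← ENNReal.ofReal_le_iff_le_toReal hE]
  have := coulombEnergy_ge hN hα hαN hp (measurableSet_annulus R L)
    (measurableSet_annulus R L) hh hu hd
    (τ := ENNReal.ofReal (((L - R) / 2) ^ N * ballVolume N)) (by
      intro x hx
      have hx0 : 0 < ‖x‖ := hR.trans hx.1
      -- `z` is the projection of `x` to the middle sphere; the ball of radius `(L - R) / 2` about
      -- `z` lies in the annulus and within distance `L - R` of `x`.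
      set ρ : ℝ := (R + L) / 2
      set z : EuclideanSpace ℝ (Fin N) := (ρ / ‖x‖) • x
      have hz : ‖z‖ = ρ := by
        rw [norm_smul, Real.norm_of_nonneg (by positivity)]
        field_simp
      have hzx : ‖z - x‖ ≤ (L - R) / 2 := by
        have : z - x = (ρ / ‖x‖ - 1) • x := by simp [z, sub_smul]
        rw [this, norm_smul, Real.norm_eq_abs, ← abs_of_pos hx0, ← abs_mul, abs_of_pos hx0]
        have : (ρ / ‖x‖ - 1) * ‖x‖ = ρ - ‖x‖ := by field_simp
        rw [this, abs_le]
        constructor <;> simp only [ρ] <;> linarith [hx.1, hx.2]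
      rw [← volume_ball_eq hN z (by linarith)]
      apply measure_mono
      intro y hy
      rw [Metric.mem_ball, dist_eq_norm] at hy
      have h1 := norm_sub_norm_le y z
      have h2 := norm_sub_norm_le z y
      rw [norm_sub_rev] at h2
      refine ⟨⟨?_, ?_⟩, ?_⟩
      · simp only [ρ] at hz; linarith
      · simp only [ρ] at hz; linarith
      · rw [Metric.mem_closedBall, dist_eq_norm]
        have := norm_add_le (y - z) (z - x)
        rw [sub_add_sub_cancel] at this
        linarith)
  rw [volume_annulus hN hR.le hRL, ← ENNReal.ofReal_mul (by positivity),
    ← ENNReal.ofReal_pow (by positivity), ← ENNReal.ofReal_mul (by positivity)] at this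
  exact this

theorem mul_exp_le_exp_sub_one (n : ℕ) {q : ℝ} (hq : 0 ≤ q) :
    q * Real.exp q ^ n ≤ Real.exp q ^ (n + 1) - 1 := by
  have h1 : q + 1 ≤ Real.exp q := Real.add_one_le_exp q
  have h2 : 1 ≤ Real.exp q ^ n := one_le_pow₀ (by linarith)
  rw [pow_succ]
  nlinarith

theorem rpow_le_mul_exp {j c : ℝ} (hj : 0 ≤ j) (hc : 0 < c) :
    ∃ D : ℝ, 0 < D ∧ ∀ q : ℝ, 0 ≤ q → q ^ j ≤ D * Real.exp (c * q) := by
  rcases hj.eq_or_lt with rfl | hj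
  · refine ⟨1, one_pos, fun q hq => ?_⟩
    simpa using Real.one_le_exp (by positivity)
  · refine ⟨(j / c) ^ j, by positivity, fun q hq => ?_⟩
    have h1 : c * q / j ≤ Real.exp (c * q / j) := by
      linarith [Real.add_one_le_exp (c * q / j)]
    calc q ^ j = (j / c) ^ j * (c * q / j) ^ j := by
          rw [← Real.mul_rpow (by positivity) (by positivity)]
          congr 1
          field_simp
      _ ≤ (j / c) ^ j * Real.exp (c * q / j) ^ j := by gcongr
      _ = _ := by
          rw [← Real.exp_mul]
          congr 2
          field_simp

/-- Lower bound of the Coulomb energy of a function that is at least `h` on a thick annulus. -/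
theorem energy_ge_exp (hN : 0 < N) (hα : 0 < α) (hαN : α < N) (hp : 0 ≤ p) :
    ∃ c : ℝ, 0 < c ∧ ∀ u : EuclideanSpace ℝ (Fin N) → ℝ, coulombEnergy N α p u ≠ ⊤ →
      ∀ R q h : ℝ, 0 < R → 0 < q → 0 ≤ h →
      (∀ᵐ x, x ∈ annulus N R (R * Real.exp q) → h ≤ |u x|) →
      c * (h ^ (2 * p) * R ^ ((N : ℝ) + α) * (q ^ 2 * Real.exp ((N + α - 2) * q))) ≤
        (coulombEnergy N α p u).toReal := by
  have hc := rieszConst_pos (N := N) (a := α / 2) (by linarith) (by linarith)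
  have hv := ballVolume_pos (N := N)
  refine ⟨(rieszConst N (α / 2) / 2 ^ ((N : ℝ) - α / 2)) ^ 2 * ballVolume N ^ 3, by positivity, ?_⟩
  intro u hE R q h hR hq hh hu
  have h1q : 1 < Real.exp q := Real.one_lt_exp_iff.2 hq
  refine le_trans ?_ (energy_ge_global hN hα hαN hp hE hR (by nlinarith) hh hu)
  obtain ⟨m, rfl⟩ : ∃ m, N = m + 1 := ⟨N - 1, by omega⟩
  -- With `N = m + 1`, the exponents of `e^q` from kernel, annulus and ball add up to `-(2N - α) +
  -- 2(N - 1) + N = N + α - 2`.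
  have hw : R ^ (m + 1) * (q * Real.exp q ^ m) ≤ (R * Real.exp q) ^ (m + 1) - R ^ (m + 1) := by
    have := mul_exp_le_exp_sub_one m hq.le
    rw [mul_pow]
    have h3 : 0 < R ^ (m + 1) := by positivity
    nlinarith
  calc _ = (rieszConst (m + 1) (α / 2) / (2 * (R * Real.exp q)) ^ (((m + 1 : ℕ) : ℝ) - α / 2) *
        h ^ p * (R ^ (m + 1) * (q * Real.exp q ^ m) * ballVolume (m + 1))) ^ 2 *
        ((R * Real.exp q) ^ (m + 1) * ballVolume (m + 1)) := by
        rw [Real.mul_rpow (by norm_num) (by positivity), Real.mul_rpow hR.le (by positivity),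
          mul_comm 2 p, Real.rpow_mul hh, Real.rpow_two]
        have e1 : R ^ (((m + 1 : ℕ) : ℝ) + α) * (R ^ (((m + 1 : ℕ) : ℝ) - α / 2)) ^ 2 =
            R ^ (3 * (m + 1)) := by
          rw [← Real.rpow_natCast, ← Real.rpow_natCast, ← Real.rpow_mul hR.le, ← Real.rpow_add hR]
          congr 1
          push_cast
          ring
        have e2 : Real.exp ((((m + 1 : ℕ) : ℝ) + α - 2) * q) *
            (Real.exp q ^ (((m + 1 : ℕ) : ℝ) - α / 2)) ^ 2 = Real.exp q ^ (3 * m + 1) := by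
          rw [← Real.exp_mul, ← Real.exp_nat_mul, ← Real.exp_nat_mul, ← Real.exp_add]
          congr 1
          push_cast
          ring
        have p1 : 0 < R ^ (((m + 1 : ℕ) : ℝ) - α / 2) := by positivity
        have p2 : 0 < Real.exp q ^ (((m + 1 : ℕ) : ℝ) - α / 2) := by positivity
        have p3 : 0 < (2 : ℝ) ^ (((m + 1 : ℕ) : ℝ) - α / 2) := by positivity
        rw [← eq_div_iff (by positivity)] at e1 e2
        rw [e1, e2]
        field_simp
        ring
    _ ≤ _ := by
        gcongr

/-- Lower bound of the Coulomb energy of a function that is at least `h` on a thin annulus. -/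
theorem energy_ge_thin (hN : 0 < N) (hα : 0 < α) (hαN : α < N) (hp : 0 ≤ p) :
    ∃ c : ℝ, 0 < c ∧ ∀ u : EuclideanSpace ℝ (Fin N) → ℝ, coulombEnergy N α p u ≠ ⊤ →
      ∀ R q h : ℝ, 0 < R → 0 < q → 0 ≤ h →
      (∀ᵐ x, x ∈ annulus N R (R * Real.exp q) → h ≤ |u x|) →
      c * (h ^ (2 * p) * R ^ ((N : ℝ) + α) * q ^ (1 + α)) ≤ (coulombEnergy N α p u).toReal := by
  have hc := rieszConst_pos (N := N) (a := α / 2) (by linarith) (by linarith)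
  have hv := ballVolume_pos (N := N)
  refine ⟨(rieszConst N (α / 2) / 2 ^ N) ^ 2 * ballVolume N ^ 3, by positivity, ?_⟩
  intro u hE R q h hR hq hh hu
  have h1q : q + 1 ≤ Real.exp q := Real.add_one_le_exp q
  refine le_trans ?_ (energy_ge_local hN hα hαN hp hE hR (by nlinarith) hh hu)
  set δ := R * Real.exp q - R with hδ
  have hδq : R * q ≤ δ := by rw [hδ]; nlinarith
  have hRq : 0 < R * q := by positivity
  have hδ0 : 0 < δ := hRq.trans_le hδq
  obtain ⟨m, rfl⟩ : ∃ m, N = m + 1 := ⟨N - 1, by omega⟩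
  have hw : R ^ (m + 1) * q ≤ (R * Real.exp q) ^ (m + 1) - R ^ (m + 1) := by
    have := mul_exp_le_exp_sub_one m hq.le
    have h2 : 1 ≤ Real.exp q ^ m := one_le_pow₀ (by linarith)
    rw [mul_pow]
    have h3 : 0 < R ^ (m + 1) := by positivity
    nlinarith [mul_le_mul_of_nonneg_left h2 hq.le]
  calc _ ≤ (rieszConst (m + 1) (α / 2) / 2 ^ (m + 1)) ^ 2 * ballVolume (m + 1) ^ 3 *
        (h ^ (2 * p) * δ ^ α * (R ^ (m + 1) * q)) := by
        have : R ^ (((m + 1 : ℕ) : ℝ) + α) * q ^ (1 + α) = (R * q) ^ α * (R ^ (m + 1) * q) := by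
          rw [Real.rpow_add hR, Real.rpow_add hq, Real.mul_rpow hR.le hq.le, Real.rpow_natCast,
            Real.rpow_one]
          ring
        rw [mul_assoc (h ^ (2 * p)), this, mul_assoc (h ^ (2 * p))]
        gcongr
    _ = (rieszConst (m + 1) (α / 2) / δ ^ (((m + 1 : ℕ) : ℝ) - α / 2) *
        h ^ p * ((δ / 2) ^ (m + 1) * ballVolume (m + 1))) ^ 2 *
        ((R ^ (m + 1) * q) * ballVolume (m + 1)) := by
        have e1 : δ ^ α * (δ ^ (((m + 1 : ℕ) : ℝ) - α / 2)) ^ 2 = δ ^ (2 * (m + 1)) := by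
          rw [← Real.rpow_natCast, ← Real.rpow_natCast, ← Real.rpow_mul hδ0.le,
            ← Real.rpow_add hδ0]
          congr 1
          push_cast
          ring
        rw [mul_comm 2 p, Real.rpow_mul hh, Real.rpow_two]
        have p1 : 0 < δ ^ (((m + 1 : ℕ) : ℝ) - α / 2) := by positivity
        rw [← eq_div_iff (by positivity)] at e1
        rw [e1, div_pow δ]
        have p2 : (0 : ℝ) < 2 ^ (m + 1) := by positivity
        generalize (2 : ℝ) ^ (m + 1) = t at p2 ⊢
        field_simp
        ring
    _ ≤ _ := by gcongr

/-- For `q ≥ 1` the exponential dominates every power. For `q ≤ 1` the long-range bound `q²`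
suffices if `k ≥ 2`, and the short-range bound `q^(1+α)` otherwise. -/
theorem energy_ge_rpow (hN : 2 ≤ N) (hα : 0 < α) (hαN : α < N) (hp : 0 ≤ p) {k : ℝ}
    (hk : 1 + min 1 α ≤ k) :
    ∃ c : ℝ, 0 < c ∧ ∀ u : EuclideanSpace ℝ (Fin N) → ℝ, coulombEnergy N α p u ≠ ⊤ →
      ∀ R q h : ℝ, 0 < R → 0 < q → 0 ≤ h →
      (∀ᵐ x, x ∈ annulus N R (R * Real.exp q) → h ≤ |u x|) →
      c * (h ^ (2 * p) * R ^ ((N : ℝ) + α) * q ^ k) ≤ (coulombEnergy N α p u).toReal := by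
  obtain ⟨c₁, hc₁, H₁⟩ := energy_ge_exp (N := N) (by omega) hα hαN hp
  obtain ⟨c₂, hc₂, H₂⟩ := energy_ge_thin (N := N) (by omega) hα hαN hp
  have hN2 : (2 : ℝ) ≤ N := by exact_mod_cast hN
  obtain ⟨D, hD, HD⟩ := rpow_le_mul_exp (j := max k 2 - 2) (c := N + α - 2)
    (by linarith [le_max_right k 2]) (by linarith)
  refine ⟨min (c₁ / D) c₂, by positivity, ?_⟩
  intro u hE R q h hR hq hh hu
  have h1 := H₁ u hE R q h hR hq hh hu
  have h2 := H₂ u hE R q h hR hq hh hu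
  have hB : 0 ≤ h ^ (2 * p) * R ^ ((N : ℝ) + α) := by positivity
  have big : q ^ k ≤ q ^ (max k 2) → min (c₁ / D) c₂ * (h ^ (2 * p) * R ^ ((N : ℝ) + α) * q ^ k) ≤
      (coulombEnergy N α p u).toReal := by
    intro hle
    refine le_trans ?_ h1
    have e : q ^ max k 2 = q ^ 2 * q ^ (max k 2 - 2) := by
      rw [← Real.rpow_two, ← Real.rpow_add hq]
      congr 1
      ring
    have h3 : q ^ k ≤ D * (q ^ 2 * Real.exp ((N + α - 2) * q)) := by
      refine hle.trans ?_
      rw [e]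
      have := HD q hq.le
      have hq2 : 0 ≤ q ^ 2 := by positivity
      nlinarith
    calc min (c₁ / D) c₂ * (h ^ (2 * p) * R ^ ((N : ℝ) + α) * q ^ k)
        ≤ c₁ / D * (h ^ (2 * p) * R ^ ((N : ℝ) + α) *
          (D * (q ^ 2 * Real.exp ((N + α - 2) * q)))) := by
          gcongr
          exact min_le_left _ _
      _ = _ := by field_simp
  rcases le_total 1 q with hq1 | hq1
  · exact big (Real.rpow_le_rpow_of_exponent_le hq1 (le_max_left _ _))
  · by_cases hk2 : 2 ≤ k
    · rw [max_eq_left hk2] at big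
      exact big le_rfl
    -- Since `k < 2`, the minimum in the hypothesis must be `α`.
    · have hk3 : 1 + α ≤ k := by
        rcases le_total 1 α with h1α | h1α
        · rw [min_eq_left h1α] at hk
          linarith
        · rwa [min_eq_right h1α] at hk
      refine le_trans ?_ h2
      gcongr ?_ * (_ * ?_)
      · exact min_le_right _ _
      · exact Real.rpow_le_rpow_of_exponent_ge hq hq1 hk3

end EnergyLowerBound

/-! ### Sufficiency of the conditions. -/

section RadialEstimate

open Filter Topology Set

variable {N : ℕ} {α p : ℝ}

/-- The logarithm covers `N = 2` together with higher dimensions and is the reason for writing outer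
radii as `R e^q`. -/
theorem integral_inv_pow_le_log (hN : 2 ≤ N) {a b : ℝ} (ha : 0 < a) (hab : a < b) :
    ∫ r in a..b, (r ^ (N - 1))⁻¹ ≤ (a ^ (N - 2))⁻¹ * Real.log (b / a) := by
  have hb := ha.trans hab
  rw [← integral_inv_of_pos ha hb, ← intervalIntegral.integral_const_mul]
  refine intervalIntegral.integral_mono_on hab.le (intervalIntegrable_inv_pow _ ha hb) ?_ ?_
  · simpa using (intervalIntegrable_inv_pow 1 ha hb).const_mul _
  · intro r hr
    have hr0 : 0 < r := ha.trans_le hr.1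
    rw [← mul_inv]
    apply inv_anti₀ (by positivity)
    obtain ⟨m, rfl⟩ : ∃ m, N = m + 2 := ⟨N - 2, by omega⟩
    simp only [Nat.add_sub_cancel, show m + 2 - 1 = m + 1 by omega, pow_succ]
    gcongr
    exact hr.1

/-- Uniformity in `b` is the point: it allows annuli of unbounded thickness in the case `θ = 1`. -/
theorem integral_inv_pow_le (hN : 3 ≤ N) {a b : ℝ} (ha : 0 < a) (hab : a < b) :
    ∫ r in a..b, (r ^ (N - 1))⁻¹ ≤ (a ^ (N - 2))⁻¹ := by
  have hb := ha.trans hab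
  obtain ⟨m, rfl⟩ : ∃ m, N = m + 3 := ⟨N - 3, by omega⟩
  have h2 : ∫ r in a..b, (r ^ 2)⁻¹ = a⁻¹ - b⁻¹ := by
    have : ∀ x ∈ uIcc a b, HasDerivAt (fun r : ℝ => -r⁻¹) ((x ^ 2)⁻¹) x := by
      intro x hx
      have hx0 : x ≠ 0 := ((lt_min ha hb).trans_le hx.1).ne'
      have h1 : HasDerivAt (fun r : ℝ => -r⁻¹) _ x := (hasDerivAt_inv hx0).neg
      simpa using h1
    rw [intervalIntegral.integral_eq_sub_of_hasDerivAt this (intervalIntegrable_inv_pow 2 ha hb)]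
    ring
  calc ∫ r in a..b, (r ^ (m + 3 - 1))⁻¹ ≤ ∫ r in a..b, (a ^ m)⁻¹ * (r ^ 2)⁻¹ := by
        refine intervalIntegral.integral_mono_on hab.le (intervalIntegrable_inv_pow _ ha hb)
          ((intervalIntegrable_inv_pow 2 ha hb).const_mul _) ?_
        intro r hr
        have hr0 : 0 < r := ha.trans_le hr.1
        rw [← mul_inv]
        apply inv_anti₀ (by positivity)
        simp only [show m + 3 - 1 = m + 2 by omega, pow_add]
        gcongr
        exact hr.1
    _ = (a ^ m)⁻¹ * (a⁻¹ - b⁻¹) := by rw [intervalIntegral.integral_const_mul, h2]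
    _ ≤ (a ^ m)⁻¹ * a⁻¹ := by
        gcongr
        have : 0 < b⁻¹ := by positivity
        linarith
    _ = _ := by
        simp only [show m + 3 - 2 = m + 1 by omega, pow_succ, mul_inv]

/-- A large value at `R` cannot decay fast under a Dirichlet bound, so it creates a plateau, whose
Coulomb energy `energy_ge_rpow` bounds from below. -/
theorem radial_estimate_rpow (hN : 2 ≤ N) (hα : 0 < α) (hαN : α < N) (hp : 0 < p) {k : ℝ}
    (hk : 1 + min 1 α ≤ k) :
    ∃ c : ℝ, 0 < c ∧ ∀ (u : EuclideanSpace ℝ (Fin N) → ℝ) (f : ℝ → ℝ)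
      (G : EuclideanSpace ℝ (Fin N) → EuclideanSpace ℝ (Fin N)), coulombEnergy N α p u ≠ ⊤ →
      (∀ᵐ x, u x = f ‖x‖) → HasWeakGradient u G → MemLp G 2 volume →
      ∀ᵐ R, 0 < R → c * |f R| ^ (2 * p + 2 * k) * R ^ ((N : ℝ) + α + (N - 2) * k) ≤
        (coulombEnergy N α p u).toReal * (∫ x, ‖G x‖ ^ 2) ^ k := by
  have hN0 : 0 < N := by omega
  have : Nonempty (Fin N) := ⟨⟨0, hN0⟩⟩
  obtain ⟨c, hc, H⟩ := energy_ge_rpow hN hα hαN hp.le hk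
  have hω := sphereArea_pos hN0
  have hk0 : 0 < k := by
    have : 0 < min 1 α := lt_min one_pos hα
    linarith
  refine ⟨c * (1 / 2) ^ (2 * p) * (sphereArea N / 4) ^ k, by positivity, ?_⟩
  intro u f G hE huf hG hG2
  obtain ⟨S, hS, hosc⟩ := radial_oscillation hN0 huf hG hG2
  filter_upwards [hS] with R hRS hR
  set A := ∫ x, ‖G x‖ ^ 2 with hA
  have hA0 : 0 ≤ A := integral_nonneg fun x => by positivity
  set e := (coulombEnergy N α p u).toReal with he
  rcases (abs_nonneg (f R)).eq_or_lt with hM | hM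
  · rw [← hM, Real.zero_rpow (by positivity)]
    have : 0 ≤ e := ENNReal.toReal_nonneg
    have : 0 ≤ A ^ k := Real.rpow_nonneg hA0 _
    simp
    positivity
  set M := |f R| with hMd
  -- `A` may vanish and `q` divides by it; hence the detour through `B > A` and the limit `B → A`.
  have key : ∀ B, A < B → c * (1 / 2) ^ (2 * p) * (sphereArea N / 4) ^ k * M ^ (2 * p + 2 * k) *
      R ^ ((N : ℝ) + α + (N - 2) * k) ≤ e * B ^ k := by
    intro B hB
    have hB0 : 0 < B := hA0.trans_lt hB
    -- The value for which the oscillation bound on `(R, R e^q)` becomes `M / 2`.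
    set q := sphereArea N * M ^ 2 * R ^ (N - 2) / (4 * B) with hq
    have hq0 : 0 < q := by positivity
    have hlow : ∀ᵐ x, x ∈ annulus N R (R * Real.exp q) → M / 2 ≤ |u x| := by
      have h1 : ∀ᵐ b, 0 < b → (R < b ∧ b < R * Real.exp q → M / 2 ≤ |f b|) := by
        filter_upwards [hS] with b hb _ hRb
        have h2 := hosc R hRS b hb hR hRb.1
        have hlog : Real.log (b / R) ≤ q := by
          rw [Real.log_le_iff_le_exp (by have := hR.trans hRb.1; positivity), div_le_iff₀ hR]
          linarith [hRb.2]
        have h3 : ∫ r in R..b, (r ^ (N - 1))⁻¹ ≤ (R ^ (N - 2))⁻¹ * q :=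
          (integral_inv_pow_le_log hN hR hRb.1).trans (by gcongr)
        have h4 : √A * √(sphereArea N * ∫ r in R..b, (r ^ (N - 1))⁻¹) ≤ sphereArea N * (M / 2) := by
          rw [← Real.sqrt_mul hA0]
          apply Real.sqrt_le_iff.2
          refine ⟨by positivity, ?_⟩
          calc A * (sphereArea N * ∫ r in R..b, (r ^ (N - 1))⁻¹)
              ≤ A * (sphereArea N * ((R ^ (N - 2))⁻¹ * q)) := by gcongr
            _ ≤ B * (sphereArea N * ((R ^ (N - 2))⁻¹ * q)) := by gcongr
            _ = _ := by
              rw [hq]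
              field_simp
              ring
        have h5 := le_of_mul_le_mul_left (h2.trans h4) hω
        have h6 := abs_sub_abs_le_abs_sub (f R) (f b)
        linarith
      filter_upwards [ae_norm_of_ae h1, huf] with x hx hxu hxa
      rw [hxu]
      exact hx hxa
    have h := H u hE R q (M / 2) hR hq0 (by positivity) hlow
    have e1 : c * ((M / 2) ^ (2 * p) * R ^ ((N : ℝ) + α) * q ^ k) =
        c * (1 / 2) ^ (2 * p) * (sphereArea N / 4) ^ k * M ^ (2 * p + 2 * k) *
        R ^ ((N : ℝ) + α + (N - 2) * k) / B ^ k := by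
      have hq' : q = sphereArea N / 4 * M ^ (2 : ℝ) * R ^ ((N : ℝ) - 2) / B := by
        rw [hq, Real.rpow_two, show ((N : ℝ) - 2) = ((N - 2 : ℕ) : ℝ) by
          rw [Nat.cast_sub hN]; norm_num, Real.rpow_natCast]
        field_simp
      rw [hq', Real.div_rpow (x := sphereArea N / 4 * M ^ (2 : ℝ) * R ^ ((N : ℝ) - 2))
          (by positivity) (by positivity),
        Real.mul_rpow (by positivity) (by positivity), Real.mul_rpow (by positivity) (by positivity),
        ← Real.rpow_mul hM.le, ← Real.rpow_mul hR.le, Real.rpow_add hM,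
        Real.rpow_add hR ((N : ℝ) + α),
        div_eq_mul_one_div M 2, Real.mul_rpow hM.le (by norm_num)]
      ring
    rw [e1, div_le_iff₀ (by positivity)] at h
    exact h
  have ht : Tendsto (fun B => e * B ^ k) (𝓝[>] A) (𝓝 (e * A ^ k)) :=
    ((Real.continuousAt_rpow_const A k (Or.inr hk0.le)).tendsto.mono_left
      nhdsWithin_le_nhds).const_mul e
  refine ge_of_tendsto ht ?_
  filter_upwards [self_mem_nhdsWithin] with B hB
  exact key B hB

/-- If the bound failed at `R`, then `|u|` would exceed a fixed `h > 0` almost everywhere outside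
the ball of radius `R`, and `energy_ge_exp` with `q → ∞` would make the Coulomb energy infinite. -/
theorem radial_estimate_gradient (hN : 3 ≤ N) (hα : 0 < α) (hαN : α < N) (hp : 0 < p)
    {u : EuclideanSpace ℝ (Fin N) → ℝ} {f : ℝ → ℝ}
    {G : EuclideanSpace ℝ (Fin N) → EuclideanSpace ℝ (Fin N)} (hE : coulombEnergy N α p u ≠ ⊤)
    (huf : ∀ᵐ x, u x = f ‖x‖) (hG : HasWeakGradient u G) (hG2 : MemLp G 2 volume) :
    ∀ᵐ R, 0 < R → sphereArea N * |f R| ≤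
      √(∫ x, ‖G x‖ ^ 2) * √(sphereArea N * (R ^ (N - 2))⁻¹) := by
  have hN0 : 0 < N := by omega
  have : Nonempty (Fin N) := ⟨⟨0, hN0⟩⟩
  obtain ⟨c, hc, H⟩ := energy_ge_exp hN0 hα hαN hp.le
  have hω := sphereArea_pos hN0
  obtain ⟨S, hS, hosc⟩ := radial_oscillation hN0 huf hG hG2
  filter_upwards [hS] with R hRS hR
  by_contra! hlt
  set K := √(∫ x, ‖G x‖ ^ 2) * √(sphereArea N * (R ^ (N - 2))⁻¹) with hK
  set h := |f R| - K / sphereArea N with hh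
  have hh0 : 0 < h := by
    rw [hh, sub_pos, div_lt_iff₀ hω]
    linarith
  have hlow : ∀ q, ∀ᵐ x, x ∈ annulus N R (R * Real.exp q) → h ≤ |u x| := by
    intro q
    have h1 : ∀ᵐ b, 0 < b → (R < b ∧ b < R * Real.exp q → h ≤ |f b|) := by
      filter_upwards [hS] with b hb _ hRb
      have h2 := hosc R hRS b hb hR hRb.1
      have h4 : sphereArea N * |f R - f b| ≤ K := h2.trans (by
        rw [hK]
        gcongr
        exact integral_inv_pow_le hN hR hRb.1)
      have h5 : |f R - f b| ≤ K / sphereArea N := by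
        rw [le_div_iff₀ hω]
        linarith
      have h6 := abs_sub_abs_le_abs_sub (f R) (f b)
      rw [hh]
      linarith
    filter_upwards [ae_norm_of_ae h1, huf] with x hx hxu hxa
    rw [hxu]
    exact hx hxa
  have hb : ∀ q : ℝ, 1 ≤ q → c * (h ^ (2 * p) * R ^ ((N : ℝ) + α)) * q ≤
      (coulombEnergy N α p u).toReal := by
    intro q hq
    refine le_trans ?_ (H u hE R q h hR (by linarith) hh0.le (hlow q))
    rw [mul_assoc]
    have h3 : (3 : ℝ) ≤ N := by exact_mod_cast hN
    have h1 : 1 ≤ Real.exp ((N + α - 2) * q) := Real.one_le_exp (by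
      apply mul_nonneg <;> linarith)
    have h4 : q ≤ q ^ 2 * Real.exp ((N + α - 2) * q) := by nlinarith
    gcongr
  set D := c * (h ^ (2 * p) * R ^ ((N : ℝ) + α)) with hD
  have hD0 : 0 < D := by positivity
  have h1 := hb (max 1 (((coulombEnergy N α p u).toReal + 1) / D)) (le_max_left _ _)
  have h2 : D * (((coulombEnergy N α p u).toReal + 1) / D) ≤
      D * max 1 (((coulombEnergy N α p u).toReal + 1) / D) := by
    gcongr
    exact le_max_right _ _
  rw [mul_div_cancel₀ _ hD0.ne'] at h2
  linarith

theorem radialDecayEstimate_of_profile {θ β : ℝ} (hN : 0 < N)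
    (h : ∃ C : ℝ, 0 < C ∧ ∀ (u : EuclideanSpace ℝ (Fin N) → ℝ) (f : ℝ → ℝ)
      (G : EuclideanSpace ℝ (Fin N) → EuclideanSpace ℝ (Fin N)), coulombEnergy N α p u ≠ ⊤ →
      (∀ᵐ x, u x = f ‖x‖) → HasWeakGradient u G → MemLp G 2 volume →
      ∀ᵐ R, 0 < R → |f R| ≤ C / R ^ β * (∫ x, ‖G x‖ ^ 2) ^ (θ / 2) *
        (coulombEnergy N α p u).toReal ^ ((1 - θ) / (2 * p))) :
    RadialDecayEstimate N α p θ β := by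
  obtain ⟨C, hC, H⟩ := h
  have : Nonempty (Fin N) := ⟨⟨0, hN⟩⟩
  refine ⟨C, hC, ?_⟩
  rintro u hu ⟨f, -, huf⟩ Du hDu
  obtain ⟨G, hG, hG2⟩ := hu.exists_grad
  have hD2 : MemLp Du 2 volume := hG2.ae_eq (hG.ae_eq hDu)
  filter_upwards [huf, ae_norm_of_ae (H u f Du hu.memCoulomb.energy_lt_top.ne huf hDu hD2)]
    with x hx hx2
  rw [hx]
  exact hx2

theorem radialDecayEstimate_of_lt_one (hN : 2 ≤ N) (hα : 0 < α) (hαN : α < N) (hp : 0 < p)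
    {θ : ℝ} (hθ : 1 / (1 + p / (1 + min 1 α)) ≤ θ) (hθ1 : θ < 1) :
    RadialDecayEstimate N α p θ
      (θ * (((N : ℝ) - 2) / 2) + (1 - θ) * (((N : ℝ) + α) / (2 * p))) := by
  have hm : 0 < min 1 α := lt_min one_pos hα
  have hθ0 : 0 < θ := lt_of_lt_of_le (by positivity) hθ
  have h1θ : 0 < 1 - θ := by linarith
  -- The exponent for which the power `σ = (1 - θ) / (2p)` of `radial_estimate_rpow` has `|f R|` to
  -- the power `1` and the Dirichlet energy to the power `θ / 2`.
  set k := p * θ / (1 - θ) with hk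
  have hk0 : 0 < k := by positivity
  have hkm : 1 + min 1 α ≤ k := by
    rw [hk, le_div_iff₀ h1θ]
    rw [div_le_iff₀ (by positivity)] at hθ
    have : θ * (1 + p / (1 + min 1 α)) * (1 + min 1 α) = θ * (1 + min 1 α) + p * θ := by
      field_simp
    nlinarith
  obtain ⟨c, hc, H⟩ := radial_estimate_rpow hN hα hαN hp hkm
  have hN0 : 0 < N := by omega
  set σ := (1 - θ) / (2 * p) with hσ
  have hσ0 : 0 < σ := by positivity
  have hkσ : k * σ = θ / 2 := by rw [hk, hσ]; field_simp
  have hMσ : (2 * p + 2 * k) * σ = 1 := by rw [hk, hσ]; field_simp; ring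
  refine radialDecayEstimate_of_profile hN0 ⟨(c⁻¹) ^ σ, by positivity, ?_⟩
  intro u f G hE huf hG hG2
  filter_upwards [H u f G hE huf hG hG2] with R hRH hR
  have h := hRH hR
  set A := ∫ x, ‖G x‖ ^ 2 with hA
  have hA0 : 0 ≤ A := integral_nonneg fun x => by positivity
  set e := (coulombEnergy N α p u).toReal with he
  have he0 : 0 ≤ e := ENNReal.toReal_nonneg
  set s := (N : ℝ) + α + (N - 2) * k with hs
  have hβ : θ * (((N : ℝ) - 2) / 2) + (1 - θ) * (((N : ℝ) + α) / (2 * p)) = s * σ := by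
    rw [hs, add_mul, mul_assoc _ k, hkσ, hσ]
    ring
  rw [hβ]
  have hR2 : 0 < R ^ s := by positivity
  have h2 : |f R| ^ (2 * p + 2 * k) ≤ c⁻¹ / R ^ s * A ^ k * e := by
    have e1 : c⁻¹ / R ^ s * A ^ k * e = e * A ^ k / (c * R ^ s) := by
      field_simp
    rw [e1, le_div_iff₀ (by positivity)]
    linarith
  have h3 := Real.rpow_le_rpow (by positivity) h2 hσ0.le
  have hAk : 0 ≤ A ^ k := Real.rpow_nonneg hA0 _
  rw [← Real.rpow_mul (abs_nonneg _), hMσ, Real.rpow_one, Real.mul_rpow (by positivity) he0,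
    Real.mul_rpow (by positivity) hAk, Real.div_rpow (by positivity) hR2.le, ← Real.rpow_mul hR.le,
    ← Real.rpow_mul hA0, hkσ] at h3
  exact h3

theorem radialDecayEstimate_one (hN : 3 ≤ N) (hα : 0 < α) (hαN : α < N) (hp : 0 < p) :
    RadialDecayEstimate N α p 1 (((N : ℝ) - 2) / 2) := by
  have hN0 : 0 < N := by omega
  have hω := sphereArea_pos hN0
  refine radialDecayEstimate_of_profile hN0 ⟨(√(sphereArea N))⁻¹, by positivity, ?_⟩
  intro u f G hE huf hG hG2
  filter_upwards [radial_estimate_gradient hN hα hαN hp hE huf hG hG2] with R hRH hR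
  have h := hRH hR
  have e1 : R ^ (((N : ℝ) - 2) / 2) = √(R ^ (N - 2)) := by
    rw [Real.sqrt_eq_rpow, ← Real.rpow_natCast, ← Real.rpow_mul hR.le, Nat.cast_sub (by omega)]
    congr 1
    push_cast
    ring
  rw [e1, ← Real.sqrt_eq_rpow]
  simp only [sub_self, zero_div, Real.rpow_zero, mul_one]
  rw [Real.sqrt_mul hω.le, Real.sqrt_inv] at h
  have hs : √(sphereArea N) * √(sphereArea N) = sphereArea N := Real.mul_self_sqrt hω.le
  have hs0 : 0 < √(sphereArea N) := Real.sqrt_pos.2 hω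
  nth_rw 1 [← hs] at h
  rw [mul_assoc, mul_left_comm (√(∫ x, ‖G x‖ ^ 2))] at h
  have h2 := le_of_mul_le_mul_left h hs0
  have hR2 : 0 < √(R ^ (N - 2)) := by positivity
  calc |f R| = (√(sphereArea N))⁻¹ * (√(sphereArea N) * |f R|) := by field_simp
    _ ≤ (√(sphereArea N))⁻¹ * (√(∫ x, ‖G x‖ ^ 2) * (√(R ^ (N - 2)))⁻¹) := by gcongr
    _ = _ := by field_simp

end RadialEstimate

/-! ### Volume growth and Riesz-type potentials of thin annuli. -/

section EnergyUpperBound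

open Filter Topology Set
open scoped Pointwise

/-- A measure with `ν(B(x,r)) ≤ D r^σ` has bounded potentials of every order `s < σ`. -/
theorem lintegral_rpow_norm_sub_le {E : Type*} [NormedAddCommGroup E] [MeasurableSpace E]
    [BorelSpace E] {s σ : ℝ} (hs : 0 < s) (hσ : s < σ) :
    ∃ K : ℝ, 0 < K ∧ ∀ (ν : Measure E) (D : ℝ), 0 ≤ D → ν univ ≤ ENNReal.ofReal D →
      (∀ (x : E) (r : ℝ), 0 < r → r ≤ 1 →
        ν (Metric.closedBall x r) ≤ ENNReal.ofReal (D * r ^ σ)) →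
      ∀ x, ∫⁻ y, ENNReal.ofReal (‖x - y‖ ^ (-s)) ∂ν ≤ ENNReal.ofReal (D * K) := by
  -- The ratio of the dyadic series: the ball of radius `2^(-j)` contributes at most `2^((j+1)s) · D
  -- 2^(-jσ) = D 2^s ρ^j`.
  set ρ : ℝ := 2 ^ (s - σ) with hρ
  have hρ0 : 0 < ρ := by positivity
  have hρ1 : ρ < 1 := Real.rpow_lt_one_of_one_lt_of_neg (by norm_num) (by linarith)
  have h1ρ : 0 < 1 - ρ := by linarith
  refine ⟨1 + 2 ^ s * (1 - ρ)⁻¹, by positivity, ?_⟩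
  intro ν D hD hν hball x
  have hpt : ∀ y, ENNReal.ofReal (‖x - y‖ ^ (-s)) ≤ 1 + ∑' j : ℕ,
      (Metric.closedBall x ((1 / 2 : ℝ) ^ j)).indicator
        (fun _ => ENNReal.ofReal ((2 : ℝ) ^ (((j : ℝ) + 1) * s))) y := by
    intro y
    rcases (norm_nonneg (x - y)).eq_or_lt with h0 | h0
    · rw [← h0, Real.zero_rpow (by linarith)]
      simp
    rcases le_total 1 ‖x - y‖ with h1 | h1
    · refine le_trans ?_ le_self_add
      rw [ENNReal.ofReal_le_one]
      exact Real.rpow_le_one_of_one_le_of_nonpos h1 (by linarith)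
    · obtain ⟨j, hj1, hj2⟩ := exists_nat_pow_near_of_lt_one h0 h1 (y := (1 / 2 : ℝ))
        (by norm_num) (by norm_num)
      refine le_trans ?_ le_add_self
      refine le_trans ?_ (ENNReal.le_tsum j)
      rw [indicator_of_mem (by rwa [Metric.mem_closedBall, dist_comm, dist_eq_norm])]
      apply ENNReal.ofReal_le_ofReal
      have h2 : ((1 / 2 : ℝ) ^ (j + 1)) = (2 : ℝ) ^ (-((j : ℝ) + 1)) := by
        rw [Real.rpow_neg (by norm_num), ← Nat.cast_add_one, Real.rpow_natCast, one_div, inv_pow]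
      rw [h2] at hj1
      calc ‖x - y‖ ^ (-s) ≤ ((2 : ℝ) ^ (-((j : ℝ) + 1))) ^ (-s) :=
            Real.rpow_le_rpow_of_nonpos (by positivity) hj1.le (by linarith)
        _ = _ := by
            rw [← Real.rpow_mul (by norm_num)]
            ring_nf
  have hsum : HasSum (fun j : ℕ => D * 2 ^ s * ρ ^ j) (D * 2 ^ s * (1 - ρ)⁻¹) :=
    (hasSum_geometric_of_lt_one hρ0.le hρ1).mul_left _
  calc ∫⁻ y, ENNReal.ofReal (‖x - y‖ ^ (-s)) ∂ν
      ≤ ∫⁻ y, (1 + ∑' j : ℕ, (Metric.closedBall x ((1 / 2 : ℝ) ^ j)).indicator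
        (fun _ => ENNReal.ofReal ((2 : ℝ) ^ (((j : ℝ) + 1) * s))) y) ∂ν := lintegral_mono hpt
    _ = ν univ + ∑' j : ℕ, ENNReal.ofReal ((2 : ℝ) ^ (((j : ℝ) + 1) * s)) *
          ν (Metric.closedBall x ((1 / 2 : ℝ) ^ j)) := by
        rw [lintegral_add_left measurable_const, lintegral_tsum]
        · simp only [lintegral_one]
          congr 2
          funext j
          rw [lintegral_indicator_const Metric.isClosed_closedBall.measurableSet]
        · intro j
          exact (measurable_const.indicator Metric.isClosed_closedBall.measurableSet).aemeasurable
    _ ≤ ENNReal.ofReal D + ∑' j : ℕ, ENNReal.ofReal (D * 2 ^ s * ρ ^ j) := by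
        refine add_le_add hν (ENNReal.tsum_le_tsum fun j => ?_)
        refine (mul_le_mul_right (hball x _ (by positivity)
          (pow_le_one₀ (by norm_num) (by norm_num))) _).trans_eq ?_
        rw [← ENNReal.ofReal_mul (by positivity)]
        congr 1
        have h2 : ((1 / 2 : ℝ) ^ j) ^ σ = (2 : ℝ) ^ (-(j : ℝ) * σ) := by
          rw [one_div, inv_pow, ← Real.rpow_natCast, ← Real.rpow_neg (by norm_num),
            ← Real.rpow_mul (by norm_num)]
        rw [h2, hρ, ← Real.rpow_natCast, ← Real.rpow_mul (by norm_num), mul_left_comm,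
          ← Real.rpow_add (by norm_num), mul_assoc, ← Real.rpow_add (by norm_num)]
        congr 2
        ring
    _ = ENNReal.ofReal (D * (1 + 2 ^ s * (1 - ρ)⁻¹)) := by
        rw [← ENNReal.ofReal_tsum_of_nonneg (fun j => by positivity) hsum.summable, hsum.tsum_eq,
          ← ENNReal.ofReal_add hD (by positivity)]
        ring_nf

variable {N : ℕ} {α p : ℝ}

theorem one_add_pow_sub_one_le {δ : ℝ} (h0 : 0 ≤ δ) (h1 : δ ≤ 1) (n : ℕ) :
    (1 + δ) ^ n - 1 ≤ n * 2 ^ n * δ := by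
  induction n with
  | zero => simp
  | succ n ih =>
    have h2 : (1 : ℝ) ≤ 2 ^ n := one_le_pow₀ (by norm_num)
    have e : (1 + δ) ^ (n + 1) - 1 = (1 + δ) * ((1 + δ) ^ n - 1) + δ := by ring
    have h3 : (0 : ℝ) ≤ n * 2 ^ n * δ := by positivity
    rw [e]
    push_cast
    calc (1 + δ) * ((1 + δ) ^ n - 1) + δ ≤ (1 + δ) * (n * 2 ^ n * δ) + δ := by gcongr
      _ ≤ 2 * (n * 2 ^ n * δ) + 2 ^ n * 2 * δ := by nlinarith
      _ = _ := by ring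

theorem volume_thin_annulus_le (hN : 0 < N) {δ : ℝ} (h0 : 0 < δ) (h1 : δ ≤ 1) :
    volume (annulus N 1 (1 + δ)) ≤ ENNReal.ofReal (N * 2 ^ N * ballVolume N * δ) := by
  rw [volume_annulus hN zero_le_one (by linarith)]
  apply ENNReal.ofReal_le_ofReal
  have := one_add_pow_sub_one_le h0.le h1 N
  have hv := ballVolume_pos (N := N)
  rw [one_pow]
  nlinarith

/-- Dilating a piece of a thin annulus fills a ball by disjoint copies. -/
theorem volume_thin_annulus_inter_le (hN : 0 < N) {δ : ℝ} (h0 : 0 < δ) (h1 : δ ≤ 1)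
    (x : EuclideanSpace ℝ (Fin N)) {r : ℝ} (hr : 0 < r) (hr1 : r ≤ 1) :
    volume (annulus N 1 (1 + δ) ∩ Metric.closedBall x r) ≤
      ENNReal.ofReal (6 ^ N * ballVolume N * δ * r ^ (N - 1)) := by
  have hv := ballVolume_pos (N := N)
  set S := annulus N 1 (1 + δ) ∩ Metric.closedBall x r with hS
  have hSm : MeasurableSet S :=
    (measurableSet_annulus _ _).inter Metric.isClosed_closedBall.measurableSet
  rcases S.eq_empty_or_nonempty with hemp | ⟨y₀, hy₀⟩
  · simp [hemp]
  -- The factors `(1 + δ)^j` map the open annulus to pairwise disjoint ones, and `j < n` keeps them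
  -- below `1 + 2r`, so about `r / δ` copies of `S` fit into a ball of radius `6r`.
  set n := ⌈r / δ⌉₊ with hn
  set t : ℕ → ℝ := fun j => (1 + δ) ^ j with ht
  have ht1 : ∀ j, 1 ≤ t j := fun j => one_le_pow₀ (by linarith)
  have ht2 : ∀ j < n, t j ≤ 1 + 2 * r := by
    intro j hj
    have hj' : (j : ℝ) * δ < r := by
      have := Nat.lt_ceil.1 hj
      rwa [lt_div_iff₀ h0] at this
    calc t j ≤ Real.exp δ ^ j := by
          simp only [ht]
          gcongr
          linarith [Real.add_one_le_exp δ]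
      _ = Real.exp (j * δ) := (Real.exp_nat_mul _ _).symm
      _ ≤ Real.exp r := Real.exp_le_exp.2 hj'.le
      _ ≤ 1 + 2 * r := by
          have := Real.abs_exp_sub_one_sub_id_le (x := r) (by rw [abs_of_pos hr]; exact hr1)
          have h3 := (abs_le.1 this).2
          nlinarith
  have hsub : ∀ j ∈ Finset.range n, t j • S ⊆ Metric.closedBall y₀ (6 * r) := by
    intro j hj
    rintro _ ⟨y, hy, rfl⟩
    have hj2 := ht2 j (Finset.mem_range.1 hj)
    rw [Metric.mem_closedBall, dist_eq_norm]
    have e : t j • y - y₀ = (t j - 1) • y + (y - x) - (y₀ - x) := by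
      rw [sub_smul, one_smul]
      abel
    have hy1 : ‖y - x‖ ≤ r := by simpa [dist_eq_norm] using hy.2
    have hy2 : ‖y₀ - x‖ ≤ r := by simpa [dist_eq_norm] using hy₀.2
    have hy3 : ‖y‖ ≤ 2 := by have := hy.1.2; linarith
    show ‖t j • y - y₀‖ ≤ _
    rw [e]
    have i1 := norm_sub_le ((t j - 1) • y + (y - x)) (y₀ - x)
    have i2 := norm_add_le ((t j - 1) • y) (y - x)
    rw [norm_smul, Real.norm_of_nonneg (by linarith [ht1 j])] at i2
    have : (t j - 1) * ‖y‖ ≤ 2 * r * 2 := by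
      apply mul_le_mul (by linarith) hy3 (norm_nonneg _) (by positivity)
    linarith
  have hdisj : Set.PairwiseDisjoint (↑(Finset.range n)) (fun j => t j • S) := by
    have aux : ∀ i j : ℕ, i < j → Disjoint (t i • S) (t j • S) := by
      intro i j hij
      rw [Set.disjoint_left]
      rintro _ ⟨y, hy, rfl⟩ ⟨z, hz, hzy⟩
      have h3 : ‖t j • z‖ = ‖t i • y‖ := congrArg norm hzy
      rw [norm_smul, norm_smul, Real.norm_of_nonneg (by linarith [ht1 j]),
        Real.norm_of_nonneg (by linarith [ht1 i])] at h3
      have h4 : t (i + 1) ≤ t j := pow_le_pow_right₀ (by linarith) hij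
      have h5 : t i * ‖y‖ < t (i + 1) := by
        simp only [ht, pow_succ]
        have := hy.1.2
        gcongr
      have h6 : t j < t j * ‖z‖ := by
        have := hz.1.1
        have := ht1 j
        nlinarith
      linarith
    intro i _ j _ hij
    rcases lt_or_gt_of_ne hij with h | h
    · exact aux i j h
    · exact (aux j i h).symm
  have hmeas : (n : ℝ≥0∞) * volume S ≤ ENNReal.ofReal ((6 * r) ^ N * ballVolume N) := by
    rw [← volume_closedBall_eq y₀ (by positivity)]
    calc (n : ℝ≥0∞) * volume S = ∑ j ∈ Finset.range n, volume S := by simp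
      _ ≤ ∑ j ∈ Finset.range n, volume (t j • S) := by
          refine Finset.sum_le_sum fun j _ => ?_
          rw [Measure.addHaar_smul]
          refine le_mul_of_one_le_left (by positivity) ?_
          rw [ENNReal.one_le_ofReal, abs_of_nonneg (pow_nonneg (by linarith [ht1 j]) _)]
          exact one_le_pow₀ (ht1 j)
      _ = volume (⋃ j ∈ Finset.range n, t j • S) :=
          (measure_biUnion_finset hdisj fun j _ =>
            hSm.const_smul₀ _).symm
      _ ≤ _ := measure_mono (Set.iUnion₂_subset hsub)
  have hfin : volume S ≠ ⊤ :=
    ((measure_mono inter_subset_right).trans_lt measure_closedBall_lt_top).ne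
  have hreal := ENNReal.toReal_mono ENNReal.ofReal_ne_top hmeas
  rw [ENNReal.toReal_mul, ENNReal.toReal_natCast, ENNReal.toReal_ofReal (by positivity)] at hreal
  rw [← ENNReal.ofReal_toReal hfin]
  apply ENNReal.ofReal_le_ofReal
  have hnr : r / δ ≤ n := Nat.le_ceil _
  have h2 : r / δ * (volume S).toReal ≤ (6 * r) ^ N * ballVolume N :=
    (mul_le_mul_of_nonneg_right hnr ENNReal.toReal_nonneg).trans hreal
  obtain ⟨m, rfl⟩ : ∃ m, N = m + 1 := ⟨N - 1, by omega⟩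
  rw [div_mul_eq_mul_div, div_le_iff₀ h0] at h2
  rw [Nat.add_sub_cancel]
  refine le_of_mul_le_mul_left (h2.trans_eq ?_) hr
  ring

/-- The annulus meets a ball of radius `r ≤ 1` in volume at most a constant times `min (r^N) (δ
r^(N-1)) ≤ δ^κ r^(N-κ)`, so the growth exponent `N - κ` is available with a factor `δ^κ`. -/
theorem potential_thin_annulus_le (hN : 0 < N) {κ s : ℝ} (hκ0 : 0 ≤ κ) (hκ1 : κ ≤ 1) (hs : 0 < s)
    (hsκ : s < N - κ) :
    ∃ K : ℝ, 0 < K ∧ ∀ δ : ℝ, 0 < δ → δ ≤ 1 → ∀ x : EuclideanSpace ℝ (Fin N),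
      ∫⁻ y in annulus N 1 (1 + δ), ENNReal.ofReal (‖x - y‖ ^ (-s)) ≤
        ENNReal.ofReal (K * δ ^ κ) := by
  obtain ⟨K, hK, H⟩ := lintegral_rpow_norm_sub_le (E := EuclideanSpace ℝ (Fin N)) hs hsκ
  have hv := ballVolume_pos (N := N)
  set D₀ : ℝ := (N * 2 ^ N + 6 ^ N) * ballVolume N with hD₀
  have hD₀0 : 0 < D₀ := by positivity
  refine ⟨D₀ * K, by positivity, ?_⟩
  intro δ h0 h1 x
  have hδκ : δ ≤ δ ^ κ := by
    simpa using Real.rpow_le_rpow_of_exponent_ge h0 h1 hκ1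
  have := H (volume.restrict (annulus N 1 (1 + δ))) (D₀ * δ ^ κ) (by positivity) ?_ ?_ x
  · rwa [mul_right_comm] at this
  · rw [Measure.restrict_apply_univ]
    refine (volume_thin_annulus_le hN h0 h1).trans (ENNReal.ofReal_le_ofReal ?_)
    have : N * 2 ^ N * ballVolume N ≤ D₀ := by
      rw [hD₀, add_mul]
      have : (0 : ℝ) < 6 ^ N * ballVolume N := by positivity
      linarith
    gcongr
  · intro x r hr hr1
    rw [Measure.restrict_apply Metric.isClosed_closedBall.measurableSet, inter_comm]
    have h6 : (1 : ℝ) ≤ 6 ^ N := one_le_pow₀ (by norm_num)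
    rcases le_total r δ with hrδ | hrδ
    · refine (measure_mono inter_subset_right).trans ?_
      rw [volume_closedBall_eq _ hr.le]
      apply ENNReal.ofReal_le_ofReal
      have e : r ^ N = r ^ κ * r ^ ((N : ℝ) - κ) := by
        rw [← Real.rpow_add hr, ← Real.rpow_natCast]
        congr 1
        ring
      rw [e]
      have : ballVolume N ≤ D₀ := by
        rw [hD₀]
        have : (0 : ℝ) ≤ N * 2 ^ N := by positivity
        nlinarith
      calc r ^ κ * r ^ ((N : ℝ) - κ) * ballVolume N
          ≤ δ ^ κ * r ^ ((N : ℝ) - κ) * D₀ := by gcongr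
        _ = _ := by ring
    · refine (volume_thin_annulus_inter_le hN h0 h1 x hr hr1).trans ?_
      apply ENNReal.ofReal_le_ofReal
      have e : δ * r ^ (N - 1) ≤ δ ^ κ * r ^ ((N : ℝ) - κ) := by
        have e1 : δ = δ ^ κ * δ ^ (1 - κ) := by
          rw [← Real.rpow_add h0]
          simp
        have e2 : r ^ ((N : ℝ) - κ) = r ^ (1 - κ) * r ^ (N - 1) := by
          rw [← Real.rpow_natCast, ← Real.rpow_add hr, Nat.cast_sub hN]
          congr 1
          push_cast
          ring
        rw [e2, ← mul_assoc]
        nth_rw 1 [e1]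
        gcongr
      have : 6 ^ N * ballVolume N ≤ D₀ := by
        rw [hD₀, add_mul]
        have : (0 : ℝ) ≤ N * 2 ^ N * ballVolume N := by positivity
        linarith
      calc 6 ^ N * ballVolume N * δ * r ^ (N - 1) = 6 ^ N * ballVolume N * (δ * r ^ (N - 1)) := by
            ring
        _ ≤ D₀ * (δ ^ κ * r ^ ((N : ℝ) - κ)) := by gcongr
        _ = _ := by ring

theorem potential_ball_le {s : ℝ} (hs : 0 < s) (hsN : s < N) (ρ : ℝ) :
    ∃ K : ℝ, 0 < K ∧ ∀ x : EuclideanSpace ℝ (Fin N),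
      ∫⁻ y in Metric.closedBall 0 ρ, ENNReal.ofReal (‖x - y‖ ^ (-s)) ≤ ENNReal.ofReal K := by
  obtain ⟨K, hK, H⟩ := lintegral_rpow_norm_sub_le (E := EuclideanSpace ℝ (Fin N)) hs hsN
  have hv := ballVolume_pos (N := N)
  set b := (volume (Metric.closedBall (0 : EuclideanSpace ℝ (Fin N)) ρ)).toReal with hb
  have hb0 : 0 ≤ b := ENNReal.toReal_nonneg
  refine ⟨(b + ballVolume N) * K, by positivity, fun x => ?_⟩
  refine H (volume.restrict (Metric.closedBall 0 ρ)) (b + ballVolume N) (by positivity) ?_ ?_ x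
  · rw [Measure.restrict_apply_univ, ← ENNReal.ofReal_toReal measure_closedBall_lt_top.ne]
    exact ENNReal.ofReal_le_ofReal (by linarith)
  · intro x r hr _
    refine (Measure.restrict_apply_le _ _).trans ?_
    rw [volume_closedBall_eq _ hr.le, Real.rpow_natCast]
    apply ENNReal.ofReal_le_ofReal
    have : 0 < r ^ N := by positivity
    nlinarith

end EnergyUpperBound

/-! ### Upper bounds for the Coulomb energy. -/

section EnergyUpperBound

open Filter Topology Set

variable {N : ℕ} {α p : ℝ}

/-- Cauchy-Schwarz on a factored kernel: one potential can then be bounded uniformly and the other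
integrated in `x`. -/
theorem sq_lintegral_rpow_le {A : Set (EuclideanSpace ℝ (Fin N))} {s t w : ℝ} (hw : s + t = 2 * w)
    (hs : 0 < s) (ht : 0 < t)
    (x : EuclideanSpace ℝ (Fin N)) :
    (∫⁻ y in A, ENNReal.ofReal (‖x - y‖ ^ (-w))) ^ 2 ≤
      (∫⁻ y in A, ENNReal.ofReal (‖x - y‖ ^ (-s))) *
        ∫⁻ y in A, ENNReal.ofReal (‖x - y‖ ^ (-t)) := by
  have hm : ∀ c : ℝ, Measurable fun y => ENNReal.ofReal (‖x - y‖ ^ c) := fun c => by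
    fun_prop
  have h := ENNReal.lintegral_mul_le_Lp_mul_Lq (volume.restrict A) Real.HolderConjugate.two_two
    (hm (-s / 2)).aemeasurable (hm (-t / 2)).aemeasurable
  have e : ∀ y, ((fun y => ENNReal.ofReal (‖x - y‖ ^ (-s / 2))) *
      fun y => ENNReal.ofReal (‖x - y‖ ^ (-t / 2))) y = ENNReal.ofReal (‖x - y‖ ^ (-w)) := by
    intro y
    rw [Pi.mul_apply, ← ENNReal.ofReal_mul (by positivity)]
    -- On the diagonal all exponents are nonzero, so every real power of `0` involved is `0`.
    rcases (norm_nonneg (x - y)).eq_or_lt with h0 | h0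
    · rw [← h0, Real.zero_rpow (by linarith), Real.zero_rpow (by linarith),
        Real.zero_rpow (by linarith), mul_zero]
    · rw [← Real.rpow_add h0]
      congr 2
      linarith
  have e2 : ∀ (c : ℝ) y, ENNReal.ofReal (‖x - y‖ ^ (-c / 2)) ^ (2 : ℝ) =
      ENNReal.ofReal (‖x - y‖ ^ (-c)) := by
    intro c y
    rw [ENNReal.ofReal_rpow_of_nonneg (by positivity) (by norm_num), ← Real.rpow_mul (norm_nonneg _)]
    congr 2
    ring
  simp only [e, e2] at h
  calc _ ≤ ((∫⁻ y in A, ENNReal.ofReal (‖x - y‖ ^ (-s))) ^ (1 / 2 : ℝ) *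
        (∫⁻ y in A, ENNReal.ofReal (‖x - y‖ ^ (-t))) ^ (1 / 2 : ℝ)) ^ 2 := by gcongr
    _ = _ := by
      rw [mul_pow, ← ENNReal.rpow_natCast, ← ENNReal.rpow_natCast, ← ENNReal.rpow_mul,
        ← ENNReal.rpow_mul]
      norm_num

/-- Split `2w = 2N - α` as `s + t`; the hypothesis on `s` makes `t < N`. On `|x| ≤ 4` the
`s`-potential is at most `Q`, and integrating the `t`-potential in `x` first leaves a multiple of
the volume of `A`. For `|x| > 4` the potential decays like `|x|^(-w)`, which is square integrable
because `2w > N`. -/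
theorem coulombEnergy_le (hαN : α < N) (hp : 0 < p) {s : ℝ}
    (hs : N - α < s) (hsN : s < N) :
    ∃ C : ℝ≥0∞, C ≠ ⊤ ∧ ∀ (A : Set (EuclideanSpace ℝ (Fin N))) (Q : ℝ≥0∞)
      (u : EuclideanSpace ℝ (Fin N) → ℝ), MeasurableSet A → A ⊆ Metric.closedBall 0 2 →
      (∀ y, |u y| ≤ 1) → (∀ y ∉ A, u y = 0) →
      (∀ x, ∫⁻ y in A, ENNReal.ofReal (‖x - y‖ ^ (-s)) ≤ Q) →
      coulombEnergy N α p u ≤ C * (Q * volume A + volume A ^ 2) := by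
  have hc := rieszConst_pos (N := N) (a := α / 2) (by linarith) (by linarith)
  set c := rieszConst N (α / 2) with hcdef
  set w : ℝ := N - α / 2 with hw
  set t : ℝ := 2 * N - α - s with ht
  obtain ⟨K, hK, HK⟩ := potential_ball_le (N := N) (s := t) (by linarith) (by linarith) 4
  set I : ℝ≥0∞ := ∫⁻ x : EuclideanSpace ℝ (Fin N), ENNReal.ofReal ((1 + ‖x‖) ^ (-(2 * w))) with hI
  have hIfin : I < ⊤ := finite_integral_one_add_norm (by simp; linarith)
  refine ⟨ENNReal.ofReal (c ^ 2) * (ENNReal.ofReal K + ENNReal.ofReal (4 ^ (2 * w)) * I), ?_, ?_⟩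
  · refine ENNReal.mul_ne_top ENNReal.ofReal_ne_top (ENNReal.add_ne_top.2 ⟨ENNReal.ofReal_ne_top, ?_⟩)
    exact ENNReal.mul_ne_top ENNReal.ofReal_ne_top hIfin.ne
  intro A Q u hA hA2 hu1 hu0 hQ
  set P : EuclideanSpace ℝ (Fin N) → ℝ≥0∞ := fun x =>
    ∫⁻ y in A, ENNReal.ofReal (‖x - y‖ ^ (-w)) with hP
  have hPot : ∀ x, rieszPotential N (α / 2) (fun y => |u y| ^ p) x ≤ ENNReal.ofReal c * P x := by
    intro x
    rw [hP, ← lintegral_const_mul _ (by fun_prop), ← lintegral_indicator hA]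
    refine lintegral_mono fun y => ?_
    by_cases hy : y ∈ A
    · rw [indicator_of_mem hy, ← ENNReal.ofReal_mul hc.le]
      have h1 : ENNReal.ofReal (|u y| ^ p) ≤ 1 := by
        rw [ENNReal.ofReal_le_one]
        exact Real.rpow_le_one (abs_nonneg _) (hu1 y) hp.le
      refine (mul_le_of_le_one_right' h1).trans (ENNReal.ofReal_le_ofReal ?_)
      rw [Real.rpow_neg (norm_nonneg _), ← div_eq_mul_inv]
      rfl
    · rw [indicator_of_notMem hy]
      simp [hu0 y hy, hp.ne']
  have hnear : ∫⁻ x in Metric.closedBall 0 4, P x ^ 2 ≤ ENNReal.ofReal K * (Q * volume A) := by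
    have hmeas : Measurable (Function.uncurry fun (x y : EuclideanSpace ℝ (Fin N)) =>
        ENNReal.ofReal (‖x - y‖ ^ (-t))) := by
      simp only [Function.uncurry_def]
      fun_prop
    calc ∫⁻ x in Metric.closedBall 0 4, P x ^ 2
        ≤ ∫⁻ x in Metric.closedBall 0 4, Q * ∫⁻ y in A, ENNReal.ofReal (‖x - y‖ ^ (-t)) := by
          refine lintegral_mono fun x => ?_
          refine (sq_lintegral_rpow_le (s := s) (t := t) (by rw [ht, hw]; ring) (by linarith)
            (by linarith) x).trans ?_
          gcongr
          exact hQ x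
      _ = Q * ∫⁻ x in Metric.closedBall 0 4, ∫⁻ y in A, ENNReal.ofReal (‖x - y‖ ^ (-t)) :=
          lintegral_const_mul _ (Measurable.lintegral_prod_right' hmeas)
      _ = Q * ∫⁻ y in A, ∫⁻ x in Metric.closedBall 0 4, ENNReal.ofReal (‖x - y‖ ^ (-t)) := by
          rw [lintegral_lintegral_swap hmeas.aemeasurable]
      _ ≤ Q * ∫⁻ y in A, ENNReal.ofReal K := by
          gcongr with y
          simp_rw [norm_sub_rev _ y]
          exact HK y
      _ = _ := by
          rw [setLIntegral_const]
          ring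
  have hfar : ∫⁻ x in (Metric.closedBall 0 4)ᶜ, P x ^ 2 ≤
      ENNReal.ofReal (4 ^ (2 * w)) * I * volume A ^ 2 := by
    have hw0 : 0 < w := by rw [hw]; linarith
    calc ∫⁻ x in (Metric.closedBall 0 4)ᶜ, P x ^ 2
        ≤ ∫⁻ x in (Metric.closedBall (0 : EuclideanSpace ℝ (Fin N)) 4)ᶜ,
          ENNReal.ofReal (4 ^ (2 * w)) * volume A ^ 2 * ENNReal.ofReal ((1 + ‖x‖) ^ (-(2 * w))) := by
          refine setLIntegral_mono' Metric.isClosed_closedBall.measurableSet.compl fun x hx => ?_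
          have hx4 : 4 < ‖x‖ := by simpa using hx
          have h1 : P x ≤ ENNReal.ofReal (((1 + ‖x‖) / 4) ^ (-w)) * volume A := by
            rw [hP, ← setLIntegral_const]
            refine setLIntegral_mono' hA fun y hy => ENNReal.ofReal_le_ofReal ?_
            have hy2 : ‖y‖ ≤ 2 := by simpa using hA2 hy
            have := norm_sub_norm_le x y
            exact Real.rpow_le_rpow_of_nonpos (by positivity) (by linarith) (by linarith)
          calc P x ^ 2 ≤ (ENNReal.ofReal (((1 + ‖x‖) / 4) ^ (-w)) * volume A) ^ 2 := by gcongr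
            _ = _ := by
              rw [mul_pow, ← ENNReal.ofReal_pow (by positivity), ← Real.rpow_natCast,
                ← Real.rpow_mul (by positivity), Real.div_rpow (by positivity) (by norm_num),
                div_eq_mul_inv, ← Real.rpow_neg (by norm_num), ENNReal.ofReal_mul (by positivity)]
              push_cast
              rw [show -w * 2 = -(2 * w) by ring, neg_neg]
              ring
      _ ≤ ∫⁻ x : EuclideanSpace ℝ (Fin N), ENNReal.ofReal (4 ^ (2 * w)) * volume A ^ 2 *
            ENNReal.ofReal ((1 + ‖x‖) ^ (-(2 * w))) := setLIntegral_le_lintegral _ _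
      _ = _ := by
          rw [lintegral_const_mul _ (by fun_prop)]
          ring
  calc coulombEnergy N α p u ≤ ∫⁻ x, ENNReal.ofReal (c ^ 2) * P x ^ 2 := by
        refine lintegral_mono fun x => ?_
        rw [ENNReal.ofReal_pow hc.le, ← mul_pow]
        gcongr
        exact hPot x
    _ = ENNReal.ofReal (c ^ 2) * ∫⁻ x, P x ^ 2 := by
        rw [lintegral_const_mul' _ _ ENNReal.ofReal_ne_top]
    _ = ENNReal.ofReal (c ^ 2) * ((∫⁻ x in Metric.closedBall 0 4, P x ^ 2) +
          ∫⁻ x in (Metric.closedBall 0 4)ᶜ, P x ^ 2) := by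
        rw [lintegral_add_compl _ Metric.isClosed_closedBall.measurableSet]
    _ ≤ ENNReal.ofReal (c ^ 2) * (ENNReal.ofReal K * (Q * volume A) +
          ENNReal.ofReal (4 ^ (2 * w)) * I * volume A ^ 2) := by gcongr
    _ ≤ ENNReal.ofReal (c ^ 2) * ((ENNReal.ofReal K + ENNReal.ofReal (4 ^ (2 * w)) * I) *
          (Q * volume A + volume A ^ 2)) := by
        gcongr
        rw [add_mul, mul_add, mul_add]
        exact add_le_add le_self_add le_add_self
    _ = _ := by ring

/-- The Coulomb energy of a function bounded by `1` and supported in a thin annulus. -/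
theorem coulombEnergy_thin_annulus_le (hN : 0 < N) (hα : 0 < α) (hαN : α < N) (hp : 0 < p) {κ : ℝ}
    (hκ0 : 0 ≤ κ) (hκ1 : κ ≤ 1) (hκα : κ < α) :
    ∃ C : ℝ, 0 < C ∧ ∀ (δ : ℝ) (u : EuclideanSpace ℝ (Fin N) → ℝ), 0 < δ → δ ≤ 1 →
      (∀ y, |u y| ≤ 1) → (∀ y ∉ annulus N 1 (1 + δ), u y = 0) →
      coulombEnergy N α p u ≤ ENNReal.ofReal (C * δ ^ (1 + κ)) := by
  -- The midpoint of `N - α` and `N - κ`; the strict inequality `κ < α` leaves room on both sides.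
  set s : ℝ := N - (κ + α) / 2 with hs
  obtain ⟨C, hC, H⟩ := coulombEnergy_le hαN hp (s := s) (by linarith) (by linarith)
  obtain ⟨K, hK, HK⟩ := potential_thin_annulus_le hN hκ0 hκ1 (s := s) (by linarith) (by linarith)
  have hv := ballVolume_pos (N := N)
  set b : ℝ := N * 2 ^ N * ballVolume N with hb
  have hb0 : 0 ≤ b := by positivity
  refine ⟨(C.toReal + 1) * (K * b + b ^ 2 + 1), by positivity, ?_⟩
  intro δ u h0 h1 hu1 hu0
  have hvol := volume_thin_annulus_le hN h0 h1
  have h2 : δ ≤ δ ^ κ := by simpa using Real.rpow_le_rpow_of_exponent_ge h0 h1 hκ1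
  have h3 : δ ^ (1 + κ) = δ * δ ^ κ := by rw [Real.rpow_add h0, Real.rpow_one]
  calc coulombEnergy N α p u ≤ C * (ENNReal.ofReal (K * δ ^ κ) * volume (annulus N 1 (1 + δ)) +
        volume (annulus N 1 (1 + δ)) ^ 2) := by
        refine H _ _ u (measurableSet_annulus _ _) ?_ hu1 hu0 (HK δ h0 h1)
        intro y hy
        have := hy.2
        rw [mem_closedBall_zero_iff]
        linarith
    _ ≤ C * (ENNReal.ofReal (K * δ ^ κ) * ENNReal.ofReal (b * δ) + ENNReal.ofReal (b * δ) ^ 2) := by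
        gcongr
    _ = ENNReal.ofReal (C.toReal * (K * δ ^ κ * (b * δ) + (b * δ) ^ 2)) := by
        rw [← ENNReal.ofReal_mul (by positivity), ← ENNReal.ofReal_pow (by positivity),
          ← ENNReal.ofReal_add (by positivity) (by positivity),
          ENNReal.ofReal_mul ENNReal.toReal_nonneg, ENNReal.ofReal_toReal hC]
    _ ≤ _ := by
        apply ENNReal.ofReal_le_ofReal
        rw [h3]
        have hC0 : 0 ≤ C.toReal := ENNReal.toReal_nonneg
        have h4 : K * δ ^ κ * (b * δ) + (b * δ) ^ 2 ≤ (K * b + b ^ 2 + 1) * (δ * δ ^ κ) := by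
          have : δ * δ ≤ δ * δ ^ κ := by gcongr
          have h5 : b ^ 2 * (δ * δ) ≤ b ^ 2 * (δ * δ ^ κ) := by gcongr
          have h6 : 0 ≤ δ * δ ^ κ := by positivity
          nlinarith
        calc C.toReal * (K * δ ^ κ * (b * δ) + (b * δ) ^ 2)
            ≤ (C.toReal + 1) * ((K * b + b ^ 2 + 1) * (δ * δ ^ κ)) := by
              gcongr
              linarith
          _ = _ := by ring

/-- Bounded functions supported in `B(0, 2)` have finite Coulomb energy. -/
theorem coulombEnergy_lt_top_of_le_one (hα : 0 < α) (hαN : α < N) (hp : 0 < p)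
    {u : EuclideanSpace ℝ (Fin N) → ℝ} (hu1 : ∀ y, |u y| ≤ 1)
    (hu0 : ∀ y ∉ Metric.closedBall 0 2, u y = 0) : coulombEnergy N α p u < ⊤ := by
  set s : ℝ := N - α / 2 with hs
  obtain ⟨C, hC, H⟩ := coulombEnergy_le hαN hp (s := s) (by linarith) (by linarith)
  obtain ⟨K, hK, HK⟩ := potential_ball_le (N := N) (s := s) (by linarith) (by linarith) 2
  refine (H _ _ u Metric.isClosed_closedBall.measurableSet le_rfl hu1 hu0 HK).trans_lt ?_
  refine ENNReal.mul_lt_top hC.lt_top (ENNReal.add_lt_top.2 ⟨?_, ?_⟩)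
  · exact ENNReal.mul_lt_top ENNReal.ofReal_lt_top measure_closedBall_lt_top
  · exact ENNReal.pow_lt_top measure_closedBall_lt_top

end EnergyUpperBound

/-! ### Scaling laws and radial test functions. -/

section TestFunctions

open Filter Topology Set

variable {N : ℕ} {α p : ℝ}

theorem lintegral_comp_smul_eq {μ : ℝ} (hμ : 0 < μ) (F : EuclideanSpace ℝ (Fin N) → ℝ≥0∞) :
    ∫⁻ x, F (μ • x) = ENNReal.ofReal (μ ^ (-(N : ℝ))) * ∫⁻ x, F x := by
  have he : MeasurableEmbedding fun x : EuclideanSpace ℝ (Fin N) => μ • x :=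
    measurableEmbedding_const_smul₀ hμ.ne'
  rw [← he.lintegral_map, Measure.map_addHaar_smul _ hμ.ne', lintegral_smul_measure]
  simp only [finrank_euclideanSpace, Fintype.card_fin, smul_eq_mul]
  rw [abs_of_pos (by positivity), Real.rpow_neg hμ.le, Real.rpow_natCast]

theorem rieszKernel_inv_smul {μ a : ℝ} (hμ : 0 < μ) (x : EuclideanSpace ℝ (Fin N)) :
    rieszKernel N a (μ⁻¹ • x) = μ ^ ((N : ℝ) - a) * rieszKernel N a x := by
  simp only [rieszKernel, norm_smul, norm_inv, Real.norm_of_nonneg hμ.le]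
  rw [Real.mul_rpow (by positivity) (norm_nonneg _), Real.inv_rpow hμ.le]
  field_simp

theorem rieszPotential_comp_smul {μ a : ℝ} (hμ : 0 < μ) (f : EuclideanSpace ℝ (Fin N) → ℝ)
    (x : EuclideanSpace ℝ (Fin N)) :
    rieszPotential N a (fun y => f (μ • y)) x =
      ENNReal.ofReal (μ ^ (-a)) * rieszPotential N a f (μ • x) := by
  unfold rieszPotential
  have h := lintegral_comp_smul_eq hμ fun z =>
    ENNReal.ofReal (rieszKernel N a (x - μ⁻¹ • z)) * ENNReal.ofReal (f z)
  simp only [inv_smul_smul₀ hμ.ne'] at h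
  rw [h]
  have e : ∀ z, ENNReal.ofReal (rieszKernel N a (x - μ⁻¹ • z)) * ENNReal.ofReal (f z) =
      ENNReal.ofReal (μ ^ ((N : ℝ) - a)) *
        (ENNReal.ofReal (rieszKernel N a (μ • x - z)) * ENNReal.ofReal (f z)) := by
    intro z
    have : x - μ⁻¹ • z = μ⁻¹ • (μ • x - z) := by rw [smul_sub, inv_smul_smul₀ hμ.ne']
    rw [this, rieszKernel_inv_smul hμ, ENNReal.ofReal_mul (by positivity), mul_assoc]
  simp_rw [e]
  rw [lintegral_const_mul' _ _ ENNReal.ofReal_ne_top, ← mul_assoc,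
    ← ENNReal.ofReal_mul (by positivity), ← Real.rpow_add hμ]
  congr 3
  ring

theorem coulombEnergy_comp_smul {μ : ℝ} (hμ : 0 < μ) (u : EuclideanSpace ℝ (Fin N) → ℝ) :
    coulombEnergy N α p (fun x => u (μ • x)) =
      ENNReal.ofReal (μ ^ (-((N : ℝ) + α))) * coulombEnergy N α p u := by
  unfold coulombEnergy
  have e : ∀ x, rieszPotential N (α / 2) (fun y => |u (μ • y)| ^ p) x = _ := fun x =>
    rieszPotential_comp_smul hμ (fun y => |u y| ^ p) x
  simp_rw [e, mul_pow]
  rw [lintegral_const_mul' _ _ (ENNReal.pow_ne_top ENNReal.ofReal_ne_top),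
    lintegral_comp_smul_eq hμ fun x => rieszPotential N (α / 2) (fun y => |u y| ^ p) x ^ 2,
    ← mul_assoc, ← ENNReal.ofReal_pow (by positivity), ← ENNReal.ofReal_mul (by positivity),
    ← Real.rpow_natCast, ← Real.rpow_mul hμ.le, ← Real.rpow_add hμ]
  congr 3
  push_cast
  ring

theorem coulombEnergy_const_mul {m : ℝ} (hm : 0 ≤ m)
    (u : EuclideanSpace ℝ (Fin N) → ℝ) :
    coulombEnergy N α p (fun x => m * u x) =
      ENNReal.ofReal (m ^ (2 * p)) * coulombEnergy N α p u := by
  unfold coulombEnergy rieszPotential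
  have e : ∀ x y : EuclideanSpace ℝ (Fin N),
      ENNReal.ofReal (rieszKernel N (α / 2) (x - y)) * ENNReal.ofReal (|m * u y| ^ p) =
      ENNReal.ofReal (m ^ p) *
        (ENNReal.ofReal (rieszKernel N (α / 2) (x - y)) * ENNReal.ofReal (|u y| ^ p)) := by
    intro x y
    rw [abs_mul, abs_of_nonneg hm, Real.mul_rpow hm (abs_nonneg _),
      ENNReal.ofReal_mul (by positivity)]
    ring
  simp_rw [e]
  simp_rw [lintegral_const_mul' _ _ ENNReal.ofReal_ne_top, mul_pow]
  rw [lintegral_const_mul' _ _ (ENNReal.pow_ne_top ENNReal.ofReal_ne_top),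
    ← ENNReal.ofReal_pow (by positivity), mul_comm 2 p, Real.rpow_mul hm, Real.rpow_two]

theorem coulombEnergy_mono (hp : 0 ≤ p) {u v : EuclideanSpace ℝ (Fin N) → ℝ}
    (h : ∀ x, |u x| ≤ |v x|) : coulombEnergy N α p u ≤ coulombEnergy N α p v := by
  unfold coulombEnergy rieszPotential
  gcongr with x y
  exact Real.rpow_le_rpow (abs_nonneg _) (h y) hp

/-- Continuous functions with compact support have finite Coulomb energy. -/
theorem coulombEnergy_lt_top (hα : 0 < α) (hαN : α < N) (hp : 0 < p)
    {u : EuclideanSpace ℝ (Fin N) → ℝ} (hu : Continuous u) (hc : HasCompactSupport u) :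
    coulombEnergy N α p u < ⊤ := by
  obtain ⟨M, hM⟩ := hc.exists_bound_of_continuous hu
  obtain ⟨ρ, hρ0, hρ⟩ := hc.isCompact.isBounded.subset_closedBall_lt 0 0
  set M' := max M 1 with hM'
  have hM0 : 0 < M' := by positivity
  -- Normalizing height and support reduces to functions bounded by `1` and supported in the ball of
  -- radius `2`.
  have e : u = fun x => M' * (fun y => (fun z => M'⁻¹ * u (ρ • z)) (ρ⁻¹ • y)) x := by
    funext x
    simp only [smul_inv_smul₀ hρ0.ne']
    field_simp
  rw [e, coulombEnergy_const_mul hM0.le,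
    coulombEnergy_comp_smul (inv_pos.2 hρ0) fun z => M'⁻¹ * u (ρ • z)]
  refine ENNReal.mul_lt_top ENNReal.ofReal_lt_top (ENNReal.mul_lt_top ENNReal.ofReal_lt_top ?_)
  refine coulombEnergy_lt_top_of_le_one hα hαN hp (fun y => ?_) fun y hy => ?_
  · rw [abs_mul, abs_of_pos (by positivity)]
    have h1 : |u (ρ • y)| ≤ M' := (hM _).trans (le_max_left _ _)
    rw [inv_mul_le_iff₀ hM0]
    simpa using h1
  · have : u (ρ • y) = 0 := by
      apply image_eq_zero_of_notMem_tsupport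
      intro hmem
      have h2 := hρ hmem
      rw [mem_closedBall_zero_iff, norm_smul, Real.norm_of_nonneg hρ0.le] at h2
      rw [mem_closedBall_zero_iff, not_le] at hy
      nlinarith
    rw [this, mul_zero]

theorem gradient_apply_eq (u : EuclideanSpace ℝ (Fin N) → ℝ) (x : EuclideanSpace ℝ (Fin N))
    (i : Fin N) : gradient u x i = fderiv ℝ u x (EuclideanSpace.single i (1 : ℝ)) := by
  have h : inner ℝ (gradient u x) (EuclideanSpace.single i (1 : ℝ)) =
      fderiv ℝ u x (EuclideanSpace.single i (1 : ℝ)) := by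
    simp [gradient]
  rw [← h, EuclideanSpace.inner_single_right]
  simp

theorem norm_gradient_eq (u : EuclideanSpace ℝ (Fin N) → ℝ) (x : EuclideanSpace ℝ (Fin N)) :
    ‖gradient u x‖ = ‖fderiv ℝ u x‖ := by
  simp [gradient]

theorem continuous_gradient {u : EuclideanSpace ℝ (Fin N) → ℝ} (hu : ContDiff ℝ ∞ u) :
    Continuous (gradient u) :=
  (InnerProductSpace.toDual ℝ (EuclideanSpace ℝ (Fin N))).symm.continuous.comp
    (hu.continuous_fderiv (by simp))

theorem hasCompactSupport_gradient {u : EuclideanSpace ℝ (Fin N) → ℝ}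
    (hc : HasCompactSupport u) : HasCompactSupport (gradient u) :=
  (hc.fderiv ℝ).comp_left (g := (InnerProductSpace.toDual ℝ (EuclideanSpace ℝ (Fin N))).symm)
    (map_zero _)

theorem hasWeakGradient_gradient {u : EuclideanSpace ℝ (Fin N) → ℝ} (hu : ContDiff ℝ ∞ u)
    (hc : HasCompactSupport u) : HasWeakGradient u (gradient u) where
  locallyIntegrable := hu.continuous.locallyIntegrable
  locallyIntegrable_grad := (continuous_gradient hu).locallyIntegrable
  integral_eq := by
    intro φ hφ hφc i
    simp_rw [gradient_apply_eq]
    have cu : Continuous fun x => fderiv ℝ u x (EuclideanSpace.single i (1 : ℝ)) :=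
      (hu.continuous_fderiv (by simp)).clm_apply continuous_const
    have cφ : Continuous fun x => fderiv ℝ φ x (EuclideanSpace.single i (1 : ℝ)) :=
      (hφ.continuous_fderiv (by simp)).clm_apply continuous_const
    apply integral_mul_fderiv_eq_neg_fderiv_mul_of_integrable
    · exact (cu.mul hφ.continuous).integrable_of_hasCompactSupport hφc.mul_left
    · exact (hu.continuous.mul cφ).integrable_of_hasCompactSupport hc.mul_right
    · exact (hu.continuous.mul hφ.continuous).integrable_of_hasCompactSupport hc.mul_right
    · exact fun x _ => (hu.differentiable (by simp)).differentiableAt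
    · exact fun x _ => (hφ.differentiable (by simp)).differentiableAt

/-- Profiles `χ` such that `x ↦ χ |x|` is a test function on `ℝ^N`. -/
structure IsTestProfile (χ : ℝ → ℝ) : Prop where
  contDiff : ContDiff ℝ ∞ χ
  exists_const : ∃ a c : ℝ, 0 < a ∧ ∀ t ≤ a, χ t = c
  exists_zero : ∃ ρ : ℝ, ∀ t, ρ ≤ t → χ t = 0

namespace IsTestProfile

variable {χ η : ℝ → ℝ}

theorem add (hχ : IsTestProfile χ) (hη : IsTestProfile η) :
    IsTestProfile fun t => χ t + η t := by
  obtain ⟨a, c, ha, h1⟩ := hχ.exists_const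
  obtain ⟨b, d, hb, h2⟩ := hη.exists_const
  obtain ⟨ρ, h3⟩ := hχ.exists_zero
  obtain ⟨ρ', h4⟩ := hη.exists_zero
  refine ⟨hχ.contDiff.add hη.contDiff, ⟨min a b, c + d, lt_min ha hb, fun t ht => ?_⟩,
    ⟨max ρ ρ', fun t ht => ?_⟩⟩
  · simp only [h1 t (ht.trans (min_le_left _ _)), h2 t (ht.trans (min_le_right _ _))]
  · simp only [h3 t ((le_max_left _ _).trans ht), h4 t ((le_max_right _ _).trans ht), add_zero]

theorem const_mul (m : ℝ) (hχ : IsTestProfile χ) : IsTestProfile fun t => m * χ t := by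
  obtain ⟨a, c, ha, h1⟩ := hχ.exists_const
  obtain ⟨ρ, h3⟩ := hχ.exists_zero
  exact ⟨contDiff_const.mul hχ.contDiff, ⟨a, m * c, ha, fun t ht => by simp only [h1 t ht]⟩,
    ⟨ρ, fun t ht => by simp only [h3 t ht, mul_zero]⟩⟩

theorem comp_mul {μ : ℝ} (hμ : 0 < μ) (hχ : IsTestProfile χ) :
    IsTestProfile fun t => χ (μ * t) := by
  obtain ⟨a, c, ha, h1⟩ := hχ.exists_const
  obtain ⟨ρ, h3⟩ := hχ.exists_zero
  refine ⟨hχ.contDiff.comp (contDiff_const.mul contDiff_id),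
    ⟨a / μ, c, by positivity, fun t ht => h1 _ ?_⟩, ⟨ρ / μ, fun t ht => h3 _ ?_⟩⟩
  · rw [le_div_iff₀ hμ] at ht
    linarith
  · rw [div_le_iff₀ hμ] at ht
    linarith

theorem contDiff_radial (hχ : IsTestProfile χ) :
    ContDiff ℝ ∞ fun x : EuclideanSpace ℝ (Fin N) => χ ‖x‖ := by
  obtain ⟨a, c, ha, h1⟩ := hχ.exists_const
  exact contDiff_comp_norm hχ.contDiff ha h1

theorem hasFDerivAt_radial (hχ : IsTestProfile χ) (x : EuclideanSpace ℝ (Fin N)) :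
    HasFDerivAt (fun x : EuclideanSpace ℝ (Fin N) => χ ‖x‖)
      ((deriv χ ‖x‖ * ‖x‖⁻¹) • innerSL ℝ x) x := by
  obtain ⟨a, c, ha, h1⟩ := hχ.exists_const
  exact hasFDerivAt_comp_norm hχ.contDiff ha h1 x

theorem hasCompactSupport_radial (hχ : IsTestProfile χ) :
    HasCompactSupport fun x : EuclideanSpace ℝ (Fin N) => χ ‖x‖ := by
  obtain ⟨ρ, h3⟩ := hχ.exists_zero
  refine HasCompactSupport.intro (isCompact_closedBall (0 : EuclideanSpace ℝ (Fin N)) ρ) ?_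
  intro x hx
  exact h3 _ (by simpa using (not_le.1 (by simpa using hx)).le)

end IsTestProfile

/-- The Dirichlet energy of `x ↦ χ |x|` on `ℝ^N`. -/
noncomputable def dirichlet (N : ℕ) (χ : ℝ → ℝ) : ℝ :=
  ∫ x : EuclideanSpace ℝ (Fin N), ‖fderiv ℝ (fun x : EuclideanSpace ℝ (Fin N) => χ ‖x‖) x‖ ^ 2

theorem dirichlet_nonneg (χ : ℝ → ℝ) : 0 ≤ dirichlet N χ := integral_nonneg fun x => by positivity

variable {χ η : ℝ → ℝ}

theorem IsTestProfile.integrable_sq (hχ : IsTestProfile χ) :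
    Integrable fun x : EuclideanSpace ℝ (Fin N) =>
      ‖fderiv ℝ (fun x : EuclideanSpace ℝ (Fin N) => χ ‖x‖) x‖ ^ 2 := by
  have hc : Continuous fun x : EuclideanSpace ℝ (Fin N) =>
      ‖fderiv ℝ (fun x : EuclideanSpace ℝ (Fin N) => χ ‖x‖) x‖ ^ 2 :=
    (hχ.contDiff_radial.continuous_fderiv (by simp)).norm.pow 2
  exact hc.integrable_of_hasCompactSupport
    ((hχ.hasCompactSupport_radial.fderiv ℝ).comp_left (g := fun L => ‖L‖ ^ 2) (by simp))

theorem dirichlet_comp_mul {μ : ℝ} (hμ : 0 < μ) :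
    dirichlet N (fun t => χ (μ * t)) = μ ^ (2 - (N : ℝ)) * dirichlet N χ := by
  have e : ∀ x : EuclideanSpace ℝ (Fin N),
      ‖fderiv ℝ (fun x : EuclideanSpace ℝ (Fin N) => χ (μ * ‖x‖)) x‖ ^ 2 =
      μ ^ 2 * ‖fderiv ℝ (fun x : EuclideanSpace ℝ (Fin N) => χ ‖x‖) (μ • x)‖ ^ 2 := by
    intro x
    have e1 : (fun x : EuclideanSpace ℝ (Fin N) => χ (μ * ‖x‖)) =
        fun x => (fun y : EuclideanSpace ℝ (Fin N) => χ ‖y‖) (μ • x) := by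
      funext y
      simp [norm_smul, abs_of_pos hμ]
    rw [e1, fderiv_comp_smul (f := fun y : EuclideanSpace ℝ (Fin N) => χ ‖y‖) μ, norm_smul, Real.norm_of_nonneg hμ.le, mul_pow]
  unfold dirichlet
  simp_rw [e]
  rw [integral_const_mul, Measure.integral_comp_smul volume (fun x : EuclideanSpace ℝ (Fin N) =>
    ‖fderiv ℝ (fun x : EuclideanSpace ℝ (Fin N) => χ ‖x‖) x‖ ^ 2) μ, smul_eq_mul, ← mul_assoc]
  congr 1
  simp only [finrank_euclideanSpace, Fintype.card_fin]
  rw [abs_of_pos (by positivity), Real.rpow_sub hμ, Real.rpow_two, Real.rpow_natCast]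
  rfl

theorem dirichlet_const_mul (hχ : IsTestProfile χ) (m : ℝ) :
    dirichlet N (fun t => m * χ t) = m ^ 2 * dirichlet N χ := by
  unfold dirichlet
  rw [← integral_const_mul]
  congr 1
  funext x
  have h : HasFDerivAt (fun x : EuclideanSpace ℝ (Fin N) => m * χ ‖x‖) _ x :=
    (hχ.hasFDerivAt_radial x).const_mul m
  rw [h.fderiv, (hχ.hasFDerivAt_radial x).fderiv, norm_smul, mul_pow]
  simp

theorem dirichlet_add_le (hχ : IsTestProfile χ) (hη : IsTestProfile η) :
    dirichlet N (fun t => χ t + η t) ≤ 2 * dirichlet N χ + 2 * dirichlet N η := by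
  unfold dirichlet
  rw [← integral_const_mul, ← integral_const_mul,
    ← integral_add (hχ.integrable_sq.const_mul 2) (hη.integrable_sq.const_mul 2)]
  refine integral_mono (hχ.add hη).integrable_sq
    ((hχ.integrable_sq.const_mul 2).add (hη.integrable_sq.const_mul 2)) fun x => ?_
  have h : HasFDerivAt (fun x : EuclideanSpace ℝ (Fin N) => χ ‖x‖ + η ‖x‖) _ x :=
    (hχ.hasFDerivAt_radial x).add (hη.hasFDerivAt_radial x)
  simp only
  rw [h.fderiv, (hχ.hasFDerivAt_radial x).fderiv, (hη.hasFDerivAt_radial x).fderiv]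
  set a := (deriv χ ‖x‖ * ‖x‖⁻¹) • innerSL ℝ x
  set b := (deriv η ‖x‖ * ‖x‖⁻¹) • innerSL ℝ x
  have h1 := norm_add_le a b
  have h2 : ‖a + b‖ ^ 2 ≤ (‖a‖ + ‖b‖) ^ 2 := by gcongr
  nlinarith [sq_nonneg (‖a‖ - ‖b‖)]

theorem IsTestProfile.coulombEnergy_lt_top (hα : 0 < α) (hαN : α < N) (hp : 0 < p)
    (hχ : IsTestProfile χ) :
    coulombEnergy N α p (fun x => χ ‖x‖) < ⊤ :=
  _root_.coulombEnergy_lt_top hα hαN hp hχ.contDiff_radial.continuous hχ.hasCompactSupport_radial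

/-- On test functions the decay estimate holds everywhere away from the origin. -/
theorem RadialDecayEstimate.profile_le (hN : 0 < N) (hα : 0 < α) (hαN : α < N) (hp : 0 < p)
    {θ β : ℝ} (h : RadialDecayEstimate N α p θ β) :
    ∃ C : ℝ, 0 < C ∧ ∀ χ, IsTestProfile χ → ∀ r, 0 < r →
      |χ r| ≤ C / r ^ β * dirichlet N χ ^ (θ / 2) *
        (coulombEnergy N α p fun x => χ ‖x‖).toReal ^ ((1 - θ) / (2 * p)) := by
  obtain ⟨C, hC, H⟩ := h
  refine ⟨C, hC, fun χ hχ r hr => ?_⟩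
  set u : EuclideanSpace ℝ (Fin N) → ℝ := fun x => χ ‖x‖ with hu
  have hcd : ContDiff ℝ ∞ u := hχ.contDiff_radial
  have hcs : HasCompactSupport u := hχ.hasCompactSupport_radial
  have hG := hasWeakGradient_gradient hcd hcs
  have hG2 : MemLp (gradient u) 2 volume :=
    (continuous_gradient hcd).memLp_of_hasCompactSupport (hasCompactSupport_gradient hcs)
  have hae := H u ⟨⟨hcd.continuous.aestronglyMeasurable, hχ.coulombEnergy_lt_top hα hαN hp⟩,
    ⟨_, hG, hG2⟩⟩ ⟨χ, hχ.contDiff.continuous.measurable, Eventually.of_forall fun x => rfl⟩ _ hG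
  simp_rw [norm_gradient_eq] at hae
  change ∀ᵐ x, |u x| ≤ C / ‖x‖ ^ β * dirichlet N χ ^ (θ / 2) * _ at hae
  set x₀ : EuclideanSpace ℝ (Fin N) := EuclideanSpace.single ⟨0, hN⟩ r with hx₀
  have hx₀r : ‖x₀‖ = r := by simp [hx₀, abs_of_pos hr]
  -- Both sides are continuous off the origin, so a strict violation would persist on an open set,
  -- which meets the dense set where the estimate holds.
  by_contra! hlt
  rw [← hx₀r] at hlt
  have hcont : ContinuousAt (fun x : EuclideanSpace ℝ (Fin N) =>
      C / ‖x‖ ^ β * dirichlet N χ ^ (θ / 2) *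
        (coulombEnergy N α p u).toReal ^ ((1 - θ) / (2 * p))) x₀ := by
    have h0 : ‖x₀‖ ≠ 0 := by rw [hx₀r]; exact hr.ne'
    have h1 : ContinuousAt (fun x : EuclideanSpace ℝ (Fin N) => ‖x‖ ^ β) x₀ :=
      continuous_norm.continuousAt.rpow_const (Or.inl h0)
    have h2 : ‖x₀‖ ^ β ≠ 0 := by rw [hx₀r]; positivity
    exact ((continuousAt_const.div h1 h2).mul continuousAt_const).mul continuousAt_const
  have hev := hcont.eventually_lt hcd.continuous.abs.continuousAt hlt
  obtain ⟨y, hy1, hy2⟩ := (Measure.dense_of_ae hae).exists_mem_open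
    isOpen_interior ⟨x₀, mem_interior_iff_mem_nhds.2 hev⟩
  have hy3 := interior_subset hy2
  exact not_lt.2 (show |u y| ≤ _ from hy1) hy3

end TestFunctions

/-! ### Necessity of the conditions. -/

section Necessity

open Filter Topology Set

variable {N : ℕ} {α p θ β : ℝ}

theorem exponent_nonpos_of_one_le {D τ : ℝ} (h : ∀ δ : ℝ, 0 < δ → δ ≤ 1 → 1 ≤ D * δ ^ τ) :
    τ ≤ 0 := by
  by_contra! hτ
  have ht : Tendsto (fun δ : ℝ => D * δ ^ τ) (𝓝[>] 0) (𝓝 (D * 0)) := by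
    have := (Real.continuousAt_rpow_const 0 τ (Or.inr hτ.le)).tendsto
    rw [Real.zero_rpow hτ.ne'] at this
    exact (this.mono_left nhdsWithin_le_nhds).const_mul D
  rw [mul_zero] at ht
  have : (1 : ℝ) ≤ 0 := by
    refine ge_of_tendsto ht ?_
    filter_upwards [Ioc_mem_nhdsGT (zero_lt_one (α := ℝ))] with δ hδ
    exact h δ hδ.1 hδ.2
  linarith

theorem exponent_eq_zero_of_one_le {D τ : ℝ} (h : ∀ μ : ℝ, 0 < μ → 1 ≤ D * μ ^ τ) : τ = 0 := by
  refine le_antisymm (exponent_nonpos_of_one_le fun δ h0 _ => h δ h0) ?_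
  have : -τ ≤ 0 := by
    refine exponent_nonpos_of_one_le (D := D) fun δ h0 _ => ?_
    have := h δ⁻¹ (inv_pos.2 h0)
    rwa [Real.inv_rpow h0.le, ← Real.rpow_neg h0.le] at this
  linarith

/-- A smooth cutoff profile, equal to `1` on `(-∞, 1]` and to `0` on `[2, ∞)`. -/
noncomputable def cutoff (t : ℝ) : ℝ := Real.smoothTransition (2 - t)

theorem cutoff_of_le {t : ℝ} (ht : t ≤ 1) : cutoff t = 1 :=
  Real.smoothTransition.one_of_one_le (by linarith)

theorem cutoff_nonneg (t : ℝ) : 0 ≤ cutoff t := Real.smoothTransition.nonneg _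

theorem cutoff_of_ge {t : ℝ} (ht : 2 ≤ t) : cutoff t = 0 :=
  Real.smoothTransition.zero_of_nonpos (by linarith)

theorem isTestProfile_cutoff : IsTestProfile cutoff :=
  ⟨Real.smoothTransition.contDiff.comp (contDiff_const.sub contDiff_id),
    ⟨1, 1, one_pos, fun _ ht => cutoff_of_le ht⟩, ⟨2, fun _ ht => cutoff_of_ge ht⟩⟩

theorem coulombEnergy_cutoff_pos (hN : 0 < N) (hα : 0 < α) (hαN : α < N) (hp : 0 < p) :
    0 < (coulombEnergy N α p fun x => cutoff ‖x‖).toReal := by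
  obtain ⟨c, hc, H⟩ := energy_ge_thin hN hα hαN hp.le
  refine lt_of_lt_of_le ?_ (H _ (isTestProfile_cutoff.coulombEnergy_lt_top hα hαN hp).ne
    (Real.exp (-1)) 1 1 (Real.exp_pos _) one_pos zero_le_one
    (Eventually.of_forall fun x hx => ?_))
  · positivity
  · rw [← Real.exp_add] at hx
    have h1 := hx.2
    norm_num at h1
    rw [cutoff_of_le h1.le, abs_one]

theorem coulombEnergy_toReal_comp_mul {μ : ℝ} (hμ : 0 < μ) (χ : ℝ → ℝ) :
    (coulombEnergy N α p fun x => χ (μ * ‖x‖)).toReal =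
      μ ^ (-((N : ℝ) + α)) * (coulombEnergy N α p fun x => χ ‖x‖).toReal := by
  have e : (fun x : EuclideanSpace ℝ (Fin N) => χ (μ * ‖x‖)) =
      fun x => (fun y : EuclideanSpace ℝ (Fin N) => χ ‖y‖) (μ • x) := by
    funext y
    simp [norm_smul, abs_of_pos hμ]
  rw [e, coulombEnergy_comp_smul hμ fun y : EuclideanSpace ℝ (Fin N) => χ ‖y‖, ENNReal.toReal_mul, ENNReal.toReal_ofReal (by positivity)]

/-- Invariance under dilations determines the power of `|x|`. -/
theorem RadialDecayEstimate.exponent_eq (hN : 0 < N) (hα : 0 < α) (hαN : α < N) (hp : 0 < p)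
    (h : RadialDecayEstimate N α p θ β) :
    β = θ * (((N : ℝ) - 2) / 2) + (1 - θ) * (((N : ℝ) + α) / (2 * p)) := by
  obtain ⟨C, hC, H⟩ := h.profile_le hN hα hαN hp
  set A := dirichlet N cutoff with hA
  have hA0 : 0 ≤ A := dirichlet_nonneg _
  set e := (coulombEnergy N α p fun x => cutoff ‖x‖).toReal with he
  have he0 : 0 ≤ e := ENNReal.toReal_nonneg
  set σ := (1 - θ) / (2 * p) with hσ
  have key : ∀ μ : ℝ, 0 < μ → 1 ≤ C * A ^ (θ / 2) * e ^ σ *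
      μ ^ (β + (2 - N) * (θ / 2) + -((N : ℝ) + α) * σ) := by
    intro μ hμ
    -- At radius `μ⁻¹` the dilated cutoff takes the value `1` for every `μ`.
    have h1 := H _ (isTestProfile_cutoff.comp_mul hμ) μ⁻¹ (inv_pos.2 hμ)
    rw [mul_inv_cancel₀ hμ.ne', cutoff_of_le le_rfl, abs_one, dirichlet_comp_mul hμ,
      coulombEnergy_toReal_comp_mul hμ, Real.mul_rpow (by positivity) hA0,
      Real.mul_rpow (by positivity) he0, Real.inv_rpow hμ.le, div_inv_eq_mul, ← Real.rpow_mul hμ.le,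
      ← Real.rpow_mul hμ.le] at h1
    rw [Real.rpow_add hμ, Real.rpow_add hμ]
    exact h1.trans_eq (by ring)
  have := exponent_eq_zero_of_one_le key
  have e1 : ((N : ℝ) + α) * σ = (1 - θ) * (((N : ℝ) + α) / (2 * p)) := by rw [hσ]; ring
  linarith

/-- Adding a bump at a different scale shows that `θ > 1` is possible only in the critical case. -/
theorem RadialDecayEstimate.le_one (hN : 0 < N) (hα : 0 < α) (hαN : α < N) (hp : 0 < p)
    (h : RadialDecayEstimate N α p θ β) (hcrit : p * ((N : ℝ) - 2) ≠ N + α) : θ ≤ 1 := by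
  by_contra! hθ
  obtain ⟨C, hC, H⟩ := h.profile_le hN hα hαN hp
  set A := dirichlet N cutoff with hA
  have hA0 : 0 ≤ A := dirichlet_nonneg _
  set e := (coulombEnergy N α p fun x => cutoff ‖x‖).toReal with he
  have he0 : 0 < e := coulombEnergy_cutoff_pos hN hα hαN hp
  set σ := (1 - θ) / (2 * p) with hσ
  have hσ0 : σ < 0 := div_neg_of_neg_of_pos (by linarith) (by positivity)
  have key : ∀ μ : ℝ, 0 < μ → 1 ≤ C * (4 * A) ^ (θ / 2) * e ^ σ *
      μ ^ ((p * ((N : ℝ) - 2) - (N + α)) * σ) := by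
    intro μ hμ
    -- This amplitude keeps the Dirichlet energy of the dilated cutoff independent of `μ`, while its
    -- Coulomb energy scales with exponent `p(N-2) - (N+α)`, nonzero outside the critical case.
    set m : ℝ := μ ^ (((N : ℝ) - 2) / 2) with hm
    have hm0 : 0 < m := by positivity
    have hT := isTestProfile_cutoff.comp_mul hμ
    have hw := isTestProfile_cutoff.add (hT.const_mul m)
    have h1 := H _ hw 1 one_pos
    simp only [Real.one_rpow, div_one] at h1
    have hval : 1 ≤ |cutoff 1 + m * cutoff (μ * 1)| := by
      rw [cutoff_of_le le_rfl]
      have := cutoff_nonneg (μ * 1)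
      exact (le_add_of_nonneg_right (by positivity)).trans (le_abs_self _)
    have hD : dirichlet N (fun t => cutoff t + m * cutoff (μ * t)) ≤ 4 * A := by
      refine (dirichlet_add_le isTestProfile_cutoff (hT.const_mul m)).trans ?_
      rw [dirichlet_const_mul hT, dirichlet_comp_mul hμ, ← mul_assoc (m ^ 2)]
      have : m ^ 2 * μ ^ (2 - (N : ℝ)) = 1 := by
        rw [hm, ← Real.rpow_natCast, ← Real.rpow_mul hμ.le, ← Real.rpow_add hμ]
        push_cast
        rw [show ((N : ℝ) - 2) / 2 * 2 + (2 - N) = 0 by ring, Real.rpow_zero]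
      rw [this]
      linarith
    have hE : μ ^ (p * ((N : ℝ) - 2) - (N + α)) * e ≤
        (coulombEnergy N α p fun x => cutoff ‖x‖ + m * cutoff (μ * ‖x‖)).toReal := by
      have h2 : coulombEnergy N α p (fun x => m * cutoff (μ * ‖x‖)) ≤
          coulombEnergy N α p fun x => cutoff ‖x‖ + m * cutoff (μ * ‖x‖) := by
        refine coulombEnergy_mono hp.le fun x => ?_
        have i1 := cutoff_nonneg ‖x‖
        have i2 := cutoff_nonneg (μ * ‖x‖)
        rw [abs_of_nonneg (by positivity), abs_of_nonneg (by positivity)]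
        linarith
      have h3 := ENNReal.toReal_mono (hw.coulombEnergy_lt_top hα hαN hp).ne h2
      refine le_trans (le_of_eq ?_) h3
      rw [coulombEnergy_const_mul hm0.le fun x => cutoff (μ * ‖x‖), ENNReal.toReal_mul,
        ENNReal.toReal_ofReal (by positivity),
        coulombEnergy_toReal_comp_mul hμ, ← mul_assoc, hm, ← Real.rpow_mul hμ.le,
        ← Real.rpow_add hμ]
      congr 2
      ring
    have hE0 : 0 < μ ^ (p * ((N : ℝ) - 2) - (N + α)) * e := by positivity
    have h4 := Real.rpow_le_rpow_of_nonpos hE0 hE hσ0.le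
    rw [Real.mul_rpow (by positivity) he0.le, ← Real.rpow_mul hμ.le] at h4
    have h5 := Real.rpow_le_rpow (dirichlet_nonneg _) hD (z := θ / 2) (by linarith)
    calc 1 ≤ _ := hval.trans h1
      _ ≤ C * (4 * A) ^ (θ / 2) * (μ ^ ((p * ((N : ℝ) - 2) - (N + α)) * σ) * e ^ σ) := by
        gcongr
      _ = _ := by ring
  have h0 := exponent_eq_zero_of_one_le key
  rcases mul_eq_zero.1 h0 with h0 | h0
  · exact hcrit (by linarith)
  · exact hσ0.ne h0

/-- A smooth bump supported in `[0, 1]` with value `1` at `1 / 2`. -/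
noncomputable def unitBump (t : ℝ) : ℝ :=
  Real.smoothTransition (4 * t) * Real.smoothTransition (4 * (1 - t))

theorem unitBump_nonneg (t : ℝ) : 0 ≤ unitBump t :=
  mul_nonneg (Real.smoothTransition.nonneg _) (Real.smoothTransition.nonneg _)

theorem unitBump_le_one (t : ℝ) : unitBump t ≤ 1 :=
  mul_le_one₀ (Real.smoothTransition.le_one _) (Real.smoothTransition.nonneg _)
    (Real.smoothTransition.le_one _)

theorem unitBump_half : unitBump (1 / 2) = 1 := by
  rw [unitBump, Real.smoothTransition.one_of_one_le (by norm_num),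
    Real.smoothTransition.one_of_one_le (by norm_num), mul_one]

theorem unitBump_of_notMem {t : ℝ} (ht : t ∉ Ioo (0 : ℝ) 1) : unitBump t = 0 := by
  rw [mem_Ioo, not_and_or, not_lt, not_lt] at ht
  rcases ht with ht | ht
  · rw [unitBump, Real.smoothTransition.zero_of_nonpos (by linarith), zero_mul]
  · rw [unitBump, Real.smoothTransition.zero_of_nonpos (x := 4 * (1 - t)) (by linarith), mul_zero]

theorem contDiff_unitBump : ContDiff ℝ ∞ unitBump :=
  (Real.smoothTransition.contDiff.comp (contDiff_const.mul contDiff_id)).mul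
    (Real.smoothTransition.contDiff.comp (contDiff_const.mul (contDiff_const.sub contDiff_id)))

theorem exists_abs_deriv_unitBump_le : ∃ L : ℝ, 0 < L ∧ ∀ t, |deriv unitBump t| ≤ L := by
  have hc : Continuous (deriv unitBump) := contDiff_unitBump.continuous_deriv (by simp)
  have hs : HasCompactSupport unitBump := by
    refine HasCompactSupport.intro isCompact_Icc (K := Icc (0 : ℝ) 1) fun t ht => ?_
    exact unitBump_of_notMem fun h => ht (Ioo_subset_Icc_self h)
  obtain ⟨L, hL⟩ := hs.deriv.exists_bound_of_continuous hc
  exact ⟨max L 1, by positivity, fun t => (hL t).trans (le_max_left _ _)⟩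

theorem deriv_unitBump_of_notMem {t : ℝ} (ht : t ∉ Ioo (0 : ℝ) 1) : deriv unitBump t = 0 := by
  apply IsLocalMin.deriv_eq_zero
  refine Eventually.of_forall fun s => ?_
  rw [unitBump_of_notMem ht]
  exact unitBump_nonneg s

/-- The bump rescaled to the interval `[1, 1 + δ]`. -/
noncomputable def thinBump (δ t : ℝ) : ℝ := unitBump ((t - 1) / δ)

theorem thinBump_of_notMem {δ t : ℝ} (hδ : 0 < δ) (ht : t ∉ Ioo 1 (1 + δ)) : thinBump δ t = 0 := by
  apply unitBump_of_notMem
  rintro ⟨h1, h2⟩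
  rw [lt_div_iff₀ hδ] at h1
  rw [div_lt_iff₀ hδ] at h2
  exact ht ⟨by linarith, by linarith⟩

theorem isTestProfile_thinBump {δ : ℝ} (hδ : 0 < δ) : IsTestProfile (thinBump δ) := by
  refine ⟨contDiff_unitBump.comp ((contDiff_id.sub contDiff_const).div_const δ),
    ⟨1, 0, one_pos, fun t ht => thinBump_of_notMem hδ fun h => ?_⟩,
    ⟨1 + δ, fun t ht => thinBump_of_notMem hδ fun h => ?_⟩⟩
  · linarith [h.1]
  · linarith [h.2]

theorem dirichlet_thinBump_le (hN : 0 < N) :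
    ∃ L : ℝ, 0 < L ∧ ∀ δ : ℝ, 0 < δ → δ ≤ 1 → dirichlet N (thinBump δ) ≤ L / δ := by
  obtain ⟨L, hL, HL⟩ := exists_abs_deriv_unitBump_le
  have hv := ballVolume_pos (N := N)
  refine ⟨L ^ 2 * (N * 2 ^ N * ballVolume N), by positivity, fun δ h0 h1 => ?_⟩
  have hT := isTestProfile_thinBump h0
  have hd : ∀ t, deriv (thinBump δ) t = deriv unitBump ((t - 1) / δ) / δ := by
    intro t
    have h2 : HasDerivAt (fun s : ℝ => (s - 1) / δ) (1 / δ) t :=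
      ((hasDerivAt_id t).sub_const 1).div_const δ
    have h3 : HasDerivAt unitBump _ ((t - 1) / δ) :=
      (contDiff_unitBump.differentiable (by simp)).differentiableAt.hasDerivAt
    have h4 : HasDerivAt (thinBump δ) _ t := h3.comp t h2
    rw [h4.deriv]
    ring
  have hS : MeasurableSet (annulus N 1 (1 + δ)) := measurableSet_annulus _ _
  have hvol := volume_thin_annulus_le hN h0 h1
  have hpt : ∀ x : EuclideanSpace ℝ (Fin N),
      ‖fderiv ℝ (fun x : EuclideanSpace ℝ (Fin N) => thinBump δ ‖x‖) x‖ ^ 2 ≤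
        (annulus N 1 (1 + δ)).indicator (fun _ => (L / δ) ^ 2) x := by
    intro x
    rw [(hT.hasFDerivAt_radial x).fderiv, hd]
    by_cases hx : x ∈ annulus N 1 (1 + δ)
    · rw [indicator_of_mem hx, norm_smul, innerSL_apply_norm, Real.norm_eq_abs, abs_mul, abs_div,
        abs_of_pos h0, abs_inv, abs_norm]
      have hx0 : 0 < ‖x‖ := zero_lt_one.trans hx.1
      rw [mul_assoc, inv_mul_cancel₀ hx0.ne', mul_one]
      gcongr
      exact HL _
    · rw [indicator_of_notMem hx, deriv_unitBump_of_notMem]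
      · simp
      · rintro ⟨h2, h3⟩
        rw [lt_div_iff₀ h0] at h2
        rw [div_lt_iff₀ h0] at h3
        exact hx ⟨by linarith, by linarith⟩
  have hfin : volume (annulus N 1 (1 + δ)) ≠ ⊤ := (hvol.trans_lt ENNReal.ofReal_lt_top).ne
  calc dirichlet N (thinBump δ)
      ≤ ∫ x, (annulus N 1 (1 + δ)).indicator (fun _ => (L / δ) ^ 2) x := by
        refine integral_mono hT.integrable_sq ?_ hpt
        exact (integrable_indicator_iff hS).2 (integrableOn_const hfin)
    _ = volume.real (annulus N 1 (1 + δ)) * (L / δ) ^ 2 := by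
        rw [integral_indicator_const _ hS, smul_eq_mul]
    _ ≤ N * 2 ^ N * ballVolume N * δ * (L / δ) ^ 2 := by
        gcongr
        exact ENNReal.toReal_le_of_le_ofReal (by positivity) hvol
    _ = _ := by field_simp

/-- Testing with bumps on thin annuli gives the lower bound for `θ`. -/
theorem RadialDecayEstimate.lower_bound (hN : 2 ≤ N) (hα : 0 < α) (hαN : α < N) (hp : 0 < p)
    (h : RadialDecayEstimate N α p θ β) : 1 / (1 + p / (1 + min 1 α)) ≤ θ := by
  by_contra! hlt
  have hN0 : 0 < N := by omega
  set θ₀ := 1 / (1 + p / (1 + min 1 α)) with hθ₀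
  have hm0 : 0 < min 1 α := lt_min one_pos hα
  have hθ₀0 : 0 < θ₀ := by positivity
  have hθ₀1 : θ₀ < 1 := by
    rw [hθ₀, div_lt_one (by positivity)]
    have : 0 < p / (1 + min 1 α) := by positivity
    linarith
  have h1θ : 0 < 1 - θ := by linarith
  have hz : p * θ / (1 - θ) - 1 < min 1 α := by
    have e : p * θ₀ = (1 - θ₀) * (1 + min 1 α) := by
      rw [hθ₀]
      field_simp
      ring
    have : p * θ / (1 - θ) < 1 + min 1 α := by
      rw [div_lt_iff₀ h1θ]
      nlinarith
    linarith
  -- The strict failure of the bound on `θ` leaves room for `κ < min 1 α` with `1 + κ` still above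
  -- `pθ/(1-θ)`; thus the Coulomb bound at the endpoint `κ = min 1 α` is not needed.
  obtain ⟨κ, hκ1, hκ2⟩ := exists_between (max_lt hm0 hz)
  have hκ0 : 0 ≤ κ := (le_max_left _ _).trans hκ1.le
  have hκz : p * θ / (1 - θ) < 1 + κ := by
    have := (le_max_right 0 (p * θ / (1 - θ) - 1)).trans_lt hκ1
    linarith
  rw [div_lt_iff₀ h1θ] at hκz
  obtain ⟨C₁, hC₁, HE⟩ := coulombEnergy_thin_annulus_le hN0 hα hαN hp hκ0
    (hκ2.le.trans (min_le_left _ _)) (hκ2.trans_le (min_le_right _ _))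
  obtain ⟨L, hL, HD⟩ := dirichlet_thinBump_le hN0
  -- Stated for a general exponent because it is applied both to `θ` and to `θ₀`.
  have test : ∀ {θ' β' : ℝ}, RadialDecayEstimate N α p θ' β' → θ' < 1 → ∃ D : ℝ, 0 < D ∧
      ∀ δ, 0 < δ → δ ≤ 1 → 1 ≤ D * dirichlet N (thinBump δ) ^ (θ' / 2) *
        δ ^ ((1 + κ) * ((1 - θ') / (2 * p))) := by
    intro θ' β' h' hθ'
    obtain ⟨C, hC, H⟩ := h'.profile_le hN0 hα hαN hp
    have hσ0 : 0 < (1 - θ') / (2 * p) := div_pos (by linarith) (by positivity)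
    refine ⟨C * 2 ^ |β'| * C₁ ^ ((1 - θ') / (2 * p)), by positivity, fun δ h0 h1 => ?_⟩
    have hr0 : 0 < 1 + δ / 2 := by positivity
    have hH := H _ (isTestProfile_thinBump h0) (1 + δ / 2) hr0
    have hval : thinBump δ (1 + δ / 2) = 1 := by
      rw [thinBump, ← unitBump_half]
      congr 1
      field_simp
      ring
    rw [hval, abs_one] at hH
    have hEb : (coulombEnergy N α p fun x => thinBump δ ‖x‖).toReal ≤ C₁ * δ ^ (1 + κ) := by
      refine ENNReal.toReal_le_of_le_ofReal (by positivity) (HE δ _ h0 h1 (fun y => ?_) fun y hy => ?_)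
      · rw [thinBump, abs_of_nonneg (unitBump_nonneg _)]
        exact unitBump_le_one _
      · exact thinBump_of_notMem h0 fun hh => hy hh
    have hpow : C / (1 + δ / 2) ^ β' ≤ C * 2 ^ |β'| := by
      rw [div_eq_mul_inv, ← Real.rpow_neg hr0.le]
      gcongr
      calc (1 + δ / 2) ^ (-β') ≤ (1 + δ / 2) ^ |β'| :=
            Real.rpow_le_rpow_of_exponent_le (by linarith) (neg_le_abs _)
        _ ≤ 2 ^ |β'| := by
            gcongr
            linarith
    have hE2 := Real.rpow_le_rpow ENNReal.toReal_nonneg hEb hσ0.le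
    rw [Real.mul_rpow hC₁.le (by positivity), ← Real.rpow_mul h0.le] at hE2
    have hA : 0 ≤ dirichlet N (thinBump δ) ^ (θ' / 2) := Real.rpow_nonneg (dirichlet_nonneg _) _
    calc (1 : ℝ) ≤ _ := hH
      _ ≤ C * 2 ^ |β'| * dirichlet N (thinBump δ) ^ (θ' / 2) *
          (C₁ ^ ((1 - θ') / (2 * p)) * δ ^ ((1 + κ) * ((1 - θ') / (2 * p)))) := by gcongr
      _ = _ := by ring
  obtain ⟨D, hD, HD1⟩ := test h (by linarith)
  rcases le_or_gt 0 θ with hθ | hθ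
  · have key : ∀ δ : ℝ, 0 < δ → δ ≤ 1 →
        1 ≤ D * L ^ (θ / 2) * δ ^ (-(θ / 2) + (1 + κ) * ((1 - θ) / (2 * p))) := by
      intro δ h0 h1
      have h2 := Real.rpow_le_rpow (dirichlet_nonneg _) (HD δ h0 h1) (z := θ / 2) (by linarith)
      rw [Real.div_rpow hL.le h0.le, div_eq_mul_inv (L ^ (θ / 2)), ← Real.rpow_neg h0.le] at h2
      rw [Real.rpow_add h0]
      calc 1 ≤ _ := HD1 δ h0 h1
        _ ≤ D * (L ^ (θ / 2) * δ ^ (-(θ / 2))) * δ ^ ((1 + κ) * ((1 - θ) / (2 * p))) := by gcongr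
        _ = _ := by ring
    have h3 := exponent_nonpos_of_one_le key
    have e : -(θ / 2) + (1 + κ) * ((1 - θ) / (2 * p)) =
        ((1 + κ) * (1 - θ) - θ * p) / (2 * p) := by
      field_simp
      ring
    rw [e] at h3
    have : 0 < ((1 + κ) * (1 - θ) - θ * p) / (2 * p) := div_pos (by linarith) (by positivity)
    linarith
  -- For `θ < 0` the Dirichlet energy must be bounded from below; the estimate already proved at the
  -- admissible exponent `θ₀` provides this uniformly in `δ`.
  · obtain ⟨D', hD', HD2⟩ := test
      (radialDecayEstimate_of_lt_one hN hα hαN hp (le_refl θ₀) hθ₀1) hθ₀1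
    have hlow : ∀ δ : ℝ, 0 < δ → δ ≤ 1 →
        (1 / D') ^ (2 / θ₀) ≤ dirichlet N (thinBump δ) := by
      intro δ h0 h1
      have h2 : δ ^ ((1 + κ) * ((1 - θ₀) / (2 * p))) ≤ 1 := by
        apply Real.rpow_le_one h0.le h1
        have : 0 < 1 - θ₀ := by linarith
        positivity
      have hA0 : 0 ≤ dirichlet N (thinBump δ) := dirichlet_nonneg _
      have hA : 0 ≤ dirichlet N (thinBump δ) ^ (θ₀ / 2) := Real.rpow_nonneg hA0 _
      have h3 : 1 ≤ D' * dirichlet N (thinBump δ) ^ (θ₀ / 2) :=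
        (HD2 δ h0 h1).trans (mul_le_of_le_one_right (by positivity) h2)
      have h4 : 1 / D' ≤ dirichlet N (thinBump δ) ^ (θ₀ / 2) := by
        rw [div_le_iff₀ hD']
        linarith
      have h5 := Real.rpow_le_rpow (by positivity) h4 (z := 2 / θ₀) (by positivity)
      rwa [← Real.rpow_mul hA0, show θ₀ / 2 * (2 / θ₀) = 1 by field_simp, Real.rpow_one] at h5
    have key : ∀ δ : ℝ, 0 < δ → δ ≤ 1 →
        1 ≤ D * ((1 / D') ^ (2 / θ₀)) ^ (θ / 2) * δ ^ ((1 + κ) * ((1 - θ) / (2 * p))) := by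
      intro δ h0 h1
      have h2 := Real.rpow_le_rpow_of_nonpos (by positivity) (hlow δ h0 h1) (z := θ / 2)
        (by linarith)
      calc 1 ≤ _ := HD1 δ h0 h1
        _ ≤ _ := by gcongr
    have h3 := exponent_nonpos_of_one_le key
    have : 0 < (1 + κ) * ((1 - θ) / (2 * p)) := by positivity
    linarith

/-- In the plane, cutoffs equal to `1` on the unit ball have arbitrarily small Dirichlet energy. -/
theorem exists_cutoff_small_dirichlet (n : ℕ) :
    ∃ (χ : ℝ → ℝ) (ρ : ℝ), IsTestProfile χ ∧ 1 ≤ ρ ∧ (∀ t ≤ 1, χ t = 1) ∧ (∀ t, ρ ≤ t → χ t = 0) ∧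
      dirichlet 2 χ ≤ (1 / 2) ^ n * dirichlet 2 cutoff := by
  induction n with
  | zero =>
    exact ⟨cutoff, 2, isTestProfile_cutoff, by norm_num, fun t ht => cutoff_of_le ht,
      fun t ht => cutoff_of_ge ht, by simp⟩
  | succ n ih =>
    obtain ⟨χ, ρ, hχ, hρ, h1, h0, hD⟩ := ih
    have hρ0 : 0 < ρ := by linarith
    -- The dilated cutoff is still `1` up to radius `2ρ`, so the gradients of the two cutoffs have
    -- disjoint supports. In the plane both have the same Dirichlet energy, hence their average has
    -- half of it.
    set μ : ℝ := (2 * ρ)⁻¹ with hμ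
    have hμ0 : 0 < μ := by positivity
    have hμρ : μ * (2 * ρ) = 1 := inv_mul_cancel₀ (by positivity)
    have hη := hχ.comp_mul hμ0
    refine ⟨fun t => 1 / 2 * (χ t + χ (μ * t)), 2 * ρ * ρ, (hχ.add hη).const_mul _, by nlinarith,
      fun t ht => ?_, fun t ht => ?_, ?_⟩
    · have : μ * t ≤ 1 := by nlinarith
      simp only [h1 t ht, h1 _ this]
      norm_num
    · have e1 : ρ ≤ t := le_trans (by nlinarith) ht
      have e2 : ρ ≤ μ * t := by
        calc ρ = μ * (2 * ρ) * ρ := by rw [hμρ, one_mul]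
          _ = μ * (2 * ρ * ρ) := by ring
          _ ≤ μ * t := by gcongr
      simp only [h0 t e1, h0 _ e2]
      norm_num
    · have hadd : dirichlet 2 (fun t => χ t + χ (μ * t)) =
          dirichlet 2 χ + dirichlet 2 (fun t => χ (μ * t)) := by
        unfold dirichlet
        rw [← integral_add hχ.integrable_sq hη.integrable_sq]
        congr 1
        funext x
        have h : HasFDerivAt
            (fun x : EuclideanSpace ℝ (Fin 2) => χ ‖x‖ + χ (μ * ‖x‖)) _ x :=
          (hχ.hasFDerivAt_radial x).add (hη.hasFDerivAt_radial x)
        rw [h.fderiv, (hχ.hasFDerivAt_radial x).fderiv, (hη.hasFDerivAt_radial x).fderiv]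
        rcases lt_or_ge ρ ‖x‖ with hx | hx
        · have : deriv χ ‖x‖ = 0 := by
            have : χ =ᶠ[𝓝 ‖x‖] fun _ => 0 := by
              filter_upwards [lt_mem_nhds hx] with t ht
              exact h0 t ht.le
            rw [this.deriv_eq, deriv_const]
          simp [this]
        · have : deriv (fun t => χ (μ * t)) ‖x‖ = 0 := by
            have : (fun t => χ (μ * t)) =ᶠ[𝓝 ‖x‖] fun _ => 1 := by
              filter_upwards [gt_mem_nhds (show ‖x‖ < 2 * ρ by linarith)] with t ht
              exact h1 _ (by nlinarith)
            rw [this.deriv_eq, deriv_const]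
          simp [this]
      rw [dirichlet_const_mul (hχ.add hη), hadd, dirichlet_comp_mul hμ0, pow_succ (1 / 2 : ℝ) n]
      push_cast
      rw [sub_self, Real.rpow_zero]
      linarith

/-- The Coulomb factor has exponent `0` here, so cutoffs with value `1` at `|x| = 1` and vanishing
Dirichlet energy are a contradiction. -/
theorem not_radialDecayEstimate_two_one_zero (hα : 0 < α) (hαN : α < (2 : ℕ)) (hp : 0 < p) :
    ¬ RadialDecayEstimate 2 α p 1 0 := by
  intro h
  obtain ⟨C, hC, H⟩ := h.profile_le (by norm_num) hα hαN hp
  have key : ∀ n : ℕ, 1 ≤ C ^ 2 * ((1 / 2) ^ n * dirichlet 2 cutoff) := by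
    intro n
    obtain ⟨χ, ρ, hχ, -, h1, -, hD⟩ := exists_cutoff_small_dirichlet n
    have h2 := H χ hχ 1 one_pos
    rw [h1 1 le_rfl] at h2
    simp only [abs_one, Real.rpow_zero, div_one, sub_self, zero_div, mul_one,
      ← Real.sqrt_eq_rpow] at h2
    have h3 : 1 ≤ (C * √(dirichlet 2 χ)) ^ 2 := one_le_pow₀ h2
    rw [mul_pow, Real.sq_sqrt (dirichlet_nonneg _)] at h3
    exact h3.trans (by gcongr)
  have ht : Tendsto (fun n : ℕ => C ^ 2 * ((1 / 2 : ℝ) ^ n * dirichlet 2 cutoff)) atTop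
      (𝓝 (C ^ 2 * (0 * dirichlet 2 cutoff))) :=
    ((tendsto_pow_atTop_nhds_zero_of_lt_one (by norm_num) (by norm_num)).mul_const _).const_mul _
  have := ge_of_tendsto' ht key
  norm_num at this

end Necessity

/-! ### The equivalence. -/

theorem mainTheorem7 (N : ℕ) (hN : 2 ≤ N) (α : ℝ) (hα : 0 < α) (hαN : α < N)
    (p : ℝ) (hp : 1 ≤ p) (θ β : ℝ) (hcrit : p * ((N : ℝ) - 2) = N + α → θ ≤ 1) :
    RadialDecayEstimate N α p θ β ↔
      (1 / (1 + p / (1 + min 1 α)) ≤ θ ∧ θ ≤ 1) ∧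
        (β = θ * (((N : ℝ) - 2) / 2) + (1 - θ) * (((N : ℝ) + α) / (2 * p)) ∧ 0 < β) := by
  have hN0 : 0 < N := by omega
  have hN2 : (2 : ℝ) ≤ N := by exact_mod_cast hN
  have hp0 : 0 < p := by linarith
  constructor
  · intro h
    have hlow := h.lower_bound hN hα hαN hp0
    have hβ := h.exponent_eq hN0 hα hαN hp0
    have hle : θ ≤ 1 := by
      by_cases hc : p * ((N : ℝ) - 2) = N + α
      · exact hcrit hc
      · exact h.le_one hN0 hα hαN hp0 hc
    refine ⟨⟨hlow, hle⟩, hβ, ?_⟩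
    have hm : 0 < min 1 α := lt_min one_pos hα
    have hθ0 : 0 < θ := lt_of_lt_of_le (by positivity) hlow
    have hq : 0 < ((N : ℝ) + α) / (2 * p) := by positivity
    have hn : 0 ≤ ((N : ℝ) - 2) / 2 := by linarith
    -- Both terms of `β` are nonnegative, and their sum vanishes only for `θ = 1` and `N = 2`.
    rcases hle.lt_or_eq with hlt | rfl
    · rw [hβ]
      have : 0 < 1 - θ := by linarith
      positivity
    · rcases hN.lt_or_eq with h3 | rfl
      · have : (3 : ℝ) ≤ N := by exact_mod_cast h3
        rw [hβ]
        linarith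
      · exfalso
        have hβ0 : β = 0 := by rw [hβ]; norm_num
        rw [hβ0] at h
        exact not_radialDecayEstimate_two_one_zero hα hαN hp0 h
  · rintro ⟨⟨hlow, hle⟩, hβ, hβ0⟩
    rcases hle.lt_or_eq with hlt | rfl
    · rw [hβ]
      exact radialDecayEstimate_of_lt_one hN hα hαN hp0 hlow hlt
    · have e : β = ((N : ℝ) - 2) / 2 := by rw [hβ]; ring
      rw [e] at hβ0 ⊢
      -- For `θ = 1` the condition `β > 0` says precisely that the dimension is at least three.
      have h3 : 3 ≤ N := by
        have : (2 : ℝ) < N := by linarith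
        exact_mod_cast this
      exact radialDecayEstimate_one h3 hα hαN hp0
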